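/- **Setting.** Consider a finite-horizon MDP with finite state space of size $S$, finite action space of size $A$, horizon $H\ge 1$, transition probabilities $P_h(s'|s,a)$ and mean costs $c_h(s,a)\in[0,1]$, $h=1,\dots,H$. An agent interacts with it for $K\ge 1$ episodes, $T=KH$, each starting in the same fixed state $s_1$; in episode $k$ it plays a policy $\pi^k$ (chosen from the past), drawing $a_h^k\sim\pi_h^k(\cdot|s_h^k)$, and, given the whole past, the cost $c_h^k\in[0,1]$ has mean $c_h(s_h^k,a_h^k)$ and $s_{h+1}^k\sim P_h(\cdot|s_h^k,a_h^k)$. Let $V_1^\pi(s)$ be the expected total cost of an episode started in $s$ under $\pi$, $V_1^*(s)=\min_\pi V_1^\pi(s)$, and $R(T)=\sum_{k=1}^K\big(V_1^{\pi^k}(s_1)-V_1^*(s_1)\big)$. Let $N_h^k(s,a)$, $C_h^k(s,a)$, $N_h^k(s,a,s')$ be the number of visits to $(s,a)$ at step $h$, the total cost incurred there, and the number of transitions from there to $s'$, before episode $k$. Before each episode $k$ a privatizer (an arbitrary randomized mechanism acting on the past) releases real-valued private versions $\widetilde N_h^k(s,a),\widetilde C_h^k(s,a),\widetilde N_h^k(s,a,s')$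 of these counts, which are $0$ for $k=1$. **Accuracy assumption at level $(\epsilon,\delta')$.** For numbers $E_{\epsilon,\delta',1},E_{\epsilon,\delta',2}>0$, with probability at least $1-\delta'$, for all $s,a,h$ and all $k\le K$: $|\widetilde N_h^k(s,a)-N_h^k(s,a)|\le E_{\epsilon,\delta',1}$, $|\widetilde C_h^k(s,a)-C_h^k(s,a)|\le E_{\epsilon,\delta',1}$, and $|\widetilde N_h^k(s,a,s')-N_h^k(s,a,s')|\le E_{\epsilon,\delta',2}$ for all $s'$. **Private-UCB-PO with confidence level $\delta'$ and step size $\eta$.** Put $D_h^k=\max\{1,\widetilde N_h^k(s,a)+E_{\epsilon,\delta',1}\}$, $\widetilde c_h^k(s,a)=\widetilde C_h^k(s,a)/D_h^k$, $\widetilde P_h^k(s'|s,a)=\widetilde N_h^k(s,a,s')/D_h^k$ and $$\beta_h^k(s,a)=\frac{L_c}{\sqrt{D_h^k}}+\frac{3E_{\epsilon,\delta',1}}{D_h^k}+H\Big(\frac{L_p}{\sqrt{D_h^k}}+\frac{S\,E_{\epsilon,\delta',2}+2E_{\epsilon,\delta',1}}{D_h^k}\Big),$$ where $L_c=\sqrt{2\ln\frac{4SAT}{\delta'}}$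 and $L_p=\sqrt{4S\ln\frac{6SAT}{\delta'}}$. Starting from $\pi_h^1(a|s)=1/A$, in each episode $k$ compute backwards from $\widetilde V_{H+1}^k=0$ $$\widetilde Q_h^k(s,a)=\min\Big\{H-h+1,\max\Big\{0,\widetilde c_h^k(s,a)+\sum_{s'}\widetilde V_{h+1}^k(s')\widetilde P_h^k(s'|s,a)-\beta_h^k(s,a)\Big\}\Big\},\quad \widetilde V_h^k(s)=\sum_a\widetilde Q_h^k(s,a)\pi_h^k(a|s),$$ play $\pi^k$, and update $\pi_h^{k+1}(a|s)\propto\pi_h^k(a|s)\exp(-\eta\widetilde Q_h^k(s,a))$. **Theorem.** There are universal constants $C>0$ and $q\in\mathbb N$ such that the following holds. Let $\epsilon>0$, $\delta\in(0,1]$ and $\eta=\sqrt{2\log A/(H^2K)}$. Run Private-UCB-PO with confidence level $\delta/2$ and step size $\eta$, with any privatizer that satisfies the accuracy assumption at level $(\epsilon,\delta/2)$. Then, with probability at least $1-\delta$, $$R(T)\le C\Big(1+\log\frac{SAT}{\delta}\Big)^q\Big(\sqrt{S^2AH^3T}+\sqrt{S^3A^2H^4}+E_{\epsilon,\delta/2,2}\,S^2AH^2+E_{\epsilon,\delta/2,1}\,SAH^2\Big).$$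 -/

import Mathlib

open MeasureTheory

noncomputable section

namespace PrivateRL

/-- A tabular episodic Markov decision process with state space `S`, action space `A` and horizon
`H`. The steps `1, …, H` of an episode are numbered `0, …, H - 1` (elements of `Fin H`); states
carry an index in `Fin (H + 1)`, the last one being the state reached after the last step. -/
structure MDP (S A : Type*) [Fintype S] (H : ℕ) where
  /-- `P h s a s'` is the probability of moving from `s` to `s'` under action `a` at step `h`. -/
  P : Fin H → S → A → S → ℝ
  /-- `c h s a` is the mean cost of action `a` in state `s` at step `h`. -/
  c : Fin H → S → A → ℝ
  P_nonneg : ∀ h s a s', 0 ≤ P h s a s'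
  P_sum : ∀ h s a, ∑ s', P h s a s' = 1
  c_nonneg : ∀ h s a, 0 ≤ c h s a
  c_le_one : ∀ h s a, c h s a ≤ 1

/-- `π h s a` is the probability of playing `a` in state `s` at step `h`; a (non-stationary,
randomized) policy is such a function whose values `π h s ·` are probability distributions. -/
def IsPolicy {S A : Type*} [Fintype A] {H : ℕ} (π : Fin H → S → A → ℝ) : Prop :=
  (∀ h s a, 0 ≤ π h s a) ∧ ∀ h s, ∑ a, π h s a = 1

section Value

variable {S A : Type*} [Fintype S] [Fintype A] [DecidableEq S] {H : ℕ}

/-- Probability that, starting from `s` at the first step and following `π`, the states of the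
episode are `σ` and its actions are `α`. -/
def trajProb (M : MDP S A H) (π : Fin H → S → A → ℝ) (s : S)
    (σ : Fin (H + 1) → S) (α : Fin H → A) : ℝ :=
  if σ 0 = s then
    ∏ h : Fin H, (π h (σ h.castSucc) (α h) * M.P h (σ h.castSucc) (α h) (σ h.succ))
  else 0

/-- The value `V₁^π(s)`: expected total cost of an episode that starts in `s` and follows `π`. -/
def value (M : MDP S A H) (π : Fin H → S → A → ℝ) (s : S) : ℝ :=
  ∑ σ : Fin (H + 1) → S, ∑ α : Fin H → A,
    trajProb M π s σ α * ∑ h : Fin H, M.c h (σ h.castSucc) (α h)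

/-- The optimal value `V₁^*(s)`, the least value of a policy. -/
def optValue (M : MDP S A H) (s : S) : ℝ :=
  ⨅ π : {π : Fin H → S → A → ℝ // IsPolicy π}, value M π.1 s

end Value

section Algorithm

variable {S A : Type*} [Fintype S] [Fintype A] {H : ℕ}

/-- The private counts that are released for one episode: of visits to `(s, a)` at step `h`,
of the cost incurred there, and of the transitions from there to `s'`. -/
structure Counts (S A : Type*) (H : ℕ) where
  N : Fin H → S → A → ℝ
  C : Fin H → S → A → ℝ
  NS : Fin H → S → A → S → ℝ

/-- The parameters of the algorithm: number of episodes, confidence level, precision levels of the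
privatizer, step size of the policy update. -/
structure Params where
  K : ℕ
  δ : ℝ
  E₁ : ℝ
  E₂ : ℝ
  η : ℝ

/-- The common denominator `max {1, Ñ_h(s,a) + E₁}` of the private estimates. -/
def den (p : Params) (n : Counts S A H) (h : Fin H) (s : S) (a : A) : ℝ :=
  max 1 (n.N h s a + p.E₁)

/-- Private mean empirical cost. -/
def costEst (p : Params) (n : Counts S A H) (h : Fin H) (s : S) (a : A) : ℝ :=
  n.C h s a / den p n h s a

/-- Private empirical transition probability. -/
def transEst (p : Params) (n : Counts S A H) (h : Fin H) (s : S) (a : A) (s' : S) : ℝ :=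
  n.NS h s a s' / den p n h s a

/-- `L_c(δ) = √(2 ln (4 S A T / δ))` with `T = K H`. -/
def Lc (S A : Type*) [Fintype S] [Fintype A] (H : ℕ) (p : Params) : ℝ :=
  Real.sqrt (2 * Real.log
    (4 * Fintype.card S * Fintype.card A * ((p.K : ℝ) * (H : ℝ)) / p.δ))

/-- `L_p(δ) = √(4 S ln (6 S A T / δ))` with `T = K H`. -/
def Lp (S A : Type*) [Fintype S] [Fintype A] (H : ℕ) (p : Params) : ℝ :=
  Real.sqrt (4 * Fintype.card S * Real.log
    (6 * Fintype.card S * Fintype.card A * ((p.K : ℝ) * (H : ℝ)) / p.δ))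

/-- Exploration bonus for the costs. -/
def bonusC (p : Params) (n : Counts S A H) (h : Fin H) (s : S) (a : A) : ℝ :=
  Lc S A H p / Real.sqrt (den p n h s a) + 3 * p.E₁ / den p n h s a

/-- Exploration bonus for the transitions. -/
def bonusP (p : Params) (n : Counts S A H) (h : Fin H) (s : S) (a : A) : ℝ :=
  Lp S A H p / Real.sqrt (den p n h s a)
    + (Fintype.card S * p.E₂ + 2 * p.E₁) / den p n h s a

/-- The exploration bonus `β = β^c + H β^p`. -/
def bonus (p : Params) (n : Counts S A H) (h : Fin H) (s : S) (a : A) : ℝ :=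
  bonusC p n h s a + (H : ℝ) * bonusP p n h s a

/-- Truncated optimistic `Q`-estimate at step `h`, from an estimate `V` of the values at the next
step. The truncation level is the number of steps left, the current one included: `H - h` with
steps numbered from `0`. -/
def qStep (p : Params) (n : Counts S A H) (h : Fin H) (V : S → ℝ) (s : S) (a : A) : ℝ :=
  min ((H : ℝ) - (h : ℕ))
    (max 0 (costEst p n h s a + ∑ s', V s' * transEst p n h s a s' - bonus p n h s a))

/-- Private value estimates `Ṽ_h`, by backward recursion from `Ṽ_{H+1} = 0`. -/
def vEst (p : Params) (n : Counts S A H) (π : Fin H → S → A → ℝ) : Fin (H + 1) → S → ℝ :=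
  Fin.reverseInduction (motive := fun _ => S → ℝ) (fun _ => 0)
    (fun h V s => ∑ a, qStep p n h V s a * π h s a)

/-- Private `Q`-estimates `Q̃_h`. -/
def qEst (p : Params) (n : Counts S A H) (π : Fin H → S → A → ℝ)
    (h : Fin H) (s : S) (a : A) : ℝ :=
  qStep p n h (vEst p n π h.succ) s a

/-- The policies of Private-UCB-PO, when the private counts used in episode `k` are `n k`
(episodes are numbered from `0`): the uniform policy first, then exponential-weights updates. -/
def policy (p : Params) (n : ℕ → Counts S A H) : ℕ → Fin H → S → A → ℝ
  | 0 => fun _ _ _ => 1 / (Fintype.card A : ℝ)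
  | k + 1 => fun h s a =>
      policy p n k h s a * Real.exp (-p.η * qEst p (n k) (policy p n k) h s a) /
        ∑ b, policy p n k h s b * Real.exp (-p.η * qEst p (n k) (policy p n k) h s b)

end Algorithm

/-- The random variables of an interaction between agent, environment and privatizer. Episodes are
numbered from `0`. -/
structure Interaction (S A : Type*) (H : ℕ) (Ω : Type*) where
  /-- `state k h` is the state in episode `k` at the beginning of step `h`. -/
  state : ℕ → Fin (H + 1) → Ω → S
  action : ℕ → Fin H → Ω → A
  cost : ℕ → Fin H → Ω → ℝ
  /-- private visit counts available at the beginning of episode `k` -/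
  privN : ℕ → Ω → Fin H → S → A → ℝ
  /-- private cumulative costs available at the beginning of episode `k` -/
  privC : ℕ → Ω → Fin H → S → A → ℝ
  /-- private transition counts available at the beginning of episode `k` -/
  privNS : ℕ → Ω → Fin H → S → A → S → ℝ

namespace Interaction

variable {S A : Type*} {H : ℕ} {Ω : Type*}

/-- The private counts available at the beginning of episode `k`. -/
def counts (X : Interaction S A H Ω) (ω : Ω) (k : ℕ) : Counts S A H :=
  ⟨X.privN k ω, X.privC k ω, X.privNS k ω⟩

/-- The true number of visits to `(s, a)` at step `h` before episode `k`. -/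
def trueN [DecidableEq S] [DecidableEq A] (X : Interaction S A H Ω) (k : ℕ) (ω : Ω)
    (h : Fin H) (s : S) (a : A) : ℝ :=
  ∑ j ∈ Finset.range k, if X.state j h.castSucc ω = s ∧ X.action j h ω = a then 1 else 0

/-- The true total cost of `(s, a)` at step `h` before episode `k`. -/
def trueC [DecidableEq S] [DecidableEq A] (X : Interaction S A H Ω) (k : ℕ) (ω : Ω)
    (h : Fin H) (s : S) (a : A) : ℝ :=
  ∑ j ∈ Finset.range k,
    if X.state j h.castSucc ω = s ∧ X.action j h ω = a then X.cost j h ω else 0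

/-- The true number of transitions from `(s, a)` to `s'` at step `h` before episode `k`. -/
def trueNS [DecidableEq S] [DecidableEq A] (X : Interaction S A H Ω) (k : ℕ) (ω : Ω)
    (h : Fin H) (s : S) (a : A) (s' : S) : ℝ :=
  ∑ j ∈ Finset.range k,
    if X.state j h.castSucc ω = s ∧ X.action j h ω = a ∧ X.state j h.succ ω = s' then 1 else 0

variable [MeasurableSpace S] [MeasurableSpace A]

/-- The history before the action at step `h` of episode `k`: all private counts released so far,
all earlier episodes, and the current episode up to the state at step `h`. -/
def preAction (X : Interaction S A H Ω) (k : ℕ) (h : Fin H) : MeasurableSpace Ω :=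
  (⨆ j ∈ Set.Iic k, (MeasurableSpace.comap (X.privN j) inferInstance
      ⊔ MeasurableSpace.comap (X.privC j) inferInstance
      ⊔ MeasurableSpace.comap (X.privNS j) inferInstance))
  ⊔ (⨆ j ∈ Set.Iio k, ((⨆ i, MeasurableSpace.comap (X.state j i) inferInstance)
      ⊔ ⨆ i, (MeasurableSpace.comap (X.action j i) inferInstance
        ⊔ MeasurableSpace.comap (X.cost j i) inferInstance)))
  ⊔ (⨆ i ∈ Set.Iic h.castSucc, MeasurableSpace.comap (X.state k i) inferInstance)
  ⊔ (⨆ i ∈ Set.Iio h, (MeasurableSpace.comap (X.action k i) inferInstance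
      ⊔ MeasurableSpace.comap (X.cost k i) inferInstance))

/-- The history after the action at step `h` of episode `k`, before its cost and the next state. -/
def postAction (X : Interaction S A H Ω) (k : ℕ) (h : Fin H) : MeasurableSpace Ω :=
  X.preAction k h ⊔ MeasurableSpace.comap (X.action k h) inferInstance

end Interaction

section Run

variable {S A : Type*} [Fintype S] [Fintype A] {H : ℕ} {Ω : Type*}

/-- `X` is a run of Private-UCB-PO with parameters `p` on the MDP `M` with initial state `s₁`.
The private counts start at zero; from then on they are produced by an arbitrary, possibly
randomized and adaptive, privatizer: their conditional law given the past is unrestricted, and the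
conditional laws of actions, costs and next states given the past (which contains the counts
released so far) are those prescribed by the agent's policy and by the MDP. -/
structure IsRun [MeasurableSpace S] [MeasurableSpace A] [MeasurableSpace Ω]
    (M : MDP S A H) (s₁ : S) (p : Params) (μ : Measure Ω) (X : Interaction S A H Ω) : Prop where
  measurable_state : ∀ k < p.K, ∀ h, Measurable (X.state k h)
  measurable_action : ∀ k < p.K, ∀ h, Measurable (X.action k h)
  measurable_cost : ∀ k < p.K, ∀ h, Measurable (X.cost k h)
  measurable_privN : ∀ k < p.K, Measurable (X.privN k)
  measurable_privC : ∀ k < p.K, Measurable (X.privC k)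
  measurable_privNS : ∀ k < p.K, Measurable (X.privNS k)
  privN_init : ∀ ω h s a, X.privN 0 ω h s a = 0
  privC_init : ∀ ω h s a, X.privC 0 ω h s a = 0
  privNS_init : ∀ ω h s a s', X.privNS 0 ω h s a s' = 0
  state_init : ∀ k < p.K, ∀ ω, X.state k 0 ω = s₁
  cost_mem : ∀ k < p.K, ∀ h, ∀ᵐ ω ∂μ, X.cost k h ω ∈ Set.Icc (0 : ℝ) 1
  /-- `a_h^k` is drawn from `π_h^k(· | s_h^k)` -/
  action_law : ∀ k < p.K, ∀ h a,
    μ[({ω | X.action k h ω = a}.indicator fun _ => (1 : ℝ)) | X.preAction k h]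
      =ᵐ[μ] fun ω => policy p (X.counts ω) k h (X.state k h.castSucc ω) a
  /-- `c_h^k` has mean `c_h(s_h^k, a_h^k)` -/
  cost_mean : ∀ k < p.K, ∀ h,
    μ[X.cost k h | X.postAction k h]
      =ᵐ[μ] fun ω => M.c h (X.state k h.castSucc ω) (X.action k h ω)
  /-- `s_{h+1}^k` is drawn from `P_h(· | s_h^k, a_h^k)` -/
  state_law : ∀ k < p.K, ∀ h s',
    μ[({ω | X.state k h.succ ω = s'}.indicator fun _ => (1 : ℝ)) | X.postAction k h]
      =ᵐ[μ] fun ω => M.P h (X.state k h.castSucc ω) (X.action k h ω) s'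

/-- With probability at least `1 - δ`, uniformly over states, actions, steps and episodes, the
private counts are within `E₁` (visits and costs) and `E₂` (transitions) of the true ones. -/
def AccurateCounts [DecidableEq S] [DecidableEq A] [MeasurableSpace Ω]
    (K : ℕ) (δ E₁ E₂ : ℝ) (μ : Measure Ω) (X : Interaction S A H Ω) : Prop :=
  1 - δ ≤ μ.real {ω | ∀ k < K, ∀ h s a,
    |X.privN k ω h s a - X.trueN k ω h s a| ≤ E₁ ∧
    |X.privC k ω h s a - X.trueC k ω h s a| ≤ E₁ ∧
    ∀ s', |X.privNS k ω h s a s' - X.trueNS k ω h s a s'| ≤ E₂}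

/-- Cumulative (pseudo) regret over `K` episodes:
`∑_k (V₁^{π^k}(s₁) - V₁^*(s₁))`, where `π^k` is the policy played in episode `k`. -/
def regret [DecidableEq S] (M : MDP S A H) (s₁ : S) (p : Params) (X : Interaction S A H Ω)
    (ω : Ω) : ℝ :=
  ∑ k ∈ Finset.range p.K, (value M (policy p (X.counts ω) k) s₁ - optValue M s₁)

end Run

end PrivateRL

end

noncomputable section

namespace PrivateRL

/-! ### Expected totals along an episode -/

section ExpectedTotal

variable {S A : Type*} [Fintype S] [Fintype A]

/-! Write Ṽ^k, Q̃^k, β^k for the estimates and bonuses of episode k. Any function V of step and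
state that vanishes after the last step equals, at the start, the expected total of its Bellman
differences under any policy (`expectedTotal_telescope`). Applied to Ṽ^k under π^k and under a fixed
competitor ρ, this splits V^{π^k} − V^ρ into an estimation error, the expected total of c + PṼ^k −
Q̃^k along π^k, and a learning error which, by the optimism Q̃^k ≤ c + PṼ^k, is at most the expected
total of ⟨π^k, Q̃^k⟩ − Q̃^k along ρ (`sum_value_sub_le`). Since ρ does not change with k, the
learning error can be summed over k separately at each step, state and action, where exponential
weights give √(2H²K log A) (`policy_regret_le`).

Optimism, and the bound min(2β^k, H) on the integrand of the estimation error, hold when the private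
counts are accurate and the true counts concentrate. Ṽ^k depends on the data, so the transition
counts are controlled on all 2^S sets of next states at once; this controls their pairing with every
function with values in [0, H] (`abs_sum_mul_le_of_subset_sums`) and costs the √S in L_p. The
deviations are measured against the square root of a random number of visits. Freezing the process
after n visits and taking a union over n ≤ K reduces them to Azuma's inequality
(`measure_sum_ge_le_of_orthogonal`, `measure_exists_lt_sum_visits_le`).

There remains the expected total of min(2β^k, H) along π^k. These functions are predictable and
bounded, so a second use of Azuma, with one increment per episode, passes to the totals over the
pairs actually visited at a cost of order H²√K (`measure_expected_sub_realized_le`). Summing 1/√n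
and 1/n over the visits (`sum_realized_bonus_le`) yields the leading term H√S·√(HSAT) = √(S²AH³T)
and the privacy terms, with a single logarithmic factor. The summand √(S³A²H⁴) is not needed and is
only kept as a nonnegative term. -/

/-- Expected total of `f` over an episode that starts in a given state, by backward recursion on
the number of steps. -/
def expectedTotal : {H : ℕ} → (Fin H → S → A → S → ℝ) → (Fin H → S → A → ℝ) →
    (Fin H → S → A → ℝ) → S → ℝ
  | 0, _, _, _ => fun _ => 0
  | _ + 1, P, π, f => fun s => ∑ a, π 0 s a * (f 0 s a + ∑ s', P 0 s a s' *
      expectedTotal (fun h => P h.succ) (fun h => π h.succ) (fun h => f h.succ) s')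

/-- Probability of a trajectory under a kernel and a policy. -/
def pathWeight [DecidableEq S] {H : ℕ} (P : Fin H → S → A → S → ℝ) (π : Fin H → S → A → ℝ) (s : S)
    (σ : Fin (H + 1) → S) (α : Fin H → A) : ℝ :=
  if σ 0 = s then
    ∏ h : Fin H, (π h (σ h.castSucc) (α h) * P h (σ h.castSucc) (α h) (σ h.succ))
  else 0

-- Only s' = σ 0 contributes to the inner sum; keeping it as a sum gives the shape of the backward
-- recursion.
omit [Fintype A] in
lemma pathWeight_cons [DecidableEq S] {H : ℕ} (P : Fin (H + 1) → S → A → S → ℝ)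
    (π : Fin (H + 1) → S → A → ℝ) (s x : S) (σ : Fin (H + 1) → S) (a : A) (α : Fin H → A) :
    pathWeight P π s (Fin.cons x σ) (Fin.cons a α) =
      if x = s then π 0 s a * ∑ s', P 0 s a s' *
        pathWeight (fun h => P h.succ) (fun h => π h.succ) s' σ α else 0 := by
  unfold pathWeight
  by_cases hx : x = s
  · subst hx
    simp [Fin.prod_univ_succ, mul_assoc]
  · simp [hx]

lemma sum_fin_succ_fun {S : Type*} [Fintype S] {n : ℕ} (f : (Fin (n + 1) → S) → ℝ) :
    ∑ σ, f σ = ∑ x, ∑ σ : Fin n → S, f (Fin.cons x σ) := by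
  rw [← (Fin.consEquiv fun _ : Fin (n + 1) => S).sum_comp, Fintype.sum_prod_type]
  rfl

/-- First-step decomposition for an arbitrary functional `F` of the trajectory: the constant 1 gives
the total mass, the total cost gives the recursion for values. -/
lemma sum_pathWeight_mul_succ [DecidableEq S] {H : ℕ} (P : Fin (H + 1) → S → A → S → ℝ)
    (π : Fin (H + 1) → S → A → ℝ) (s : S) (F : (Fin (H + 2) → S) → (Fin (H + 1) → A) → ℝ) :
    ∑ σ, ∑ α, pathWeight P π s σ α * F σ α =
      ∑ a, π 0 s a * ∑ s', P 0 s a s' * ∑ σ, ∑ α,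
        pathWeight (fun h => P h.succ) (fun h => π h.succ) s' σ α *
          F (Fin.cons s σ) (Fin.cons a α) := by
  rw [sum_fin_succ_fun]
  have h1 : ∀ x σ, ∑ α, pathWeight P π s (Fin.cons x σ) α * F (Fin.cons x σ) α =
      if x = s then ∑ a, ∑ α, π 0 s a * ∑ s', P 0 s a s' *
        (pathWeight (fun h => P h.succ) (fun h => π h.succ) s' σ α *
          F (Fin.cons s σ) (Fin.cons a α)) else 0 := by
    intro x σ
    rw [sum_fin_succ_fun]
    simp only [pathWeight_cons]
    by_cases hx : x = s
    · subst hx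
      simp only [if_true, Finset.mul_sum, Finset.sum_mul, mul_assoc]
    · simp [hx]
  simp only [h1]
  rw [Finset.sum_comm]
  simp only [Finset.sum_ite_eq', Finset.mem_univ, if_true]
  rw [Finset.sum_comm]
  refine Finset.sum_congr rfl fun a _ => ?_
  simp only [Finset.mul_sum]
  rw [Finset.sum_comm' (t' := Finset.univ) (s' := fun _ => Finset.univ) (by simp)]
  rw [Finset.sum_comm]
  calc _ = ∑ σ, ∑ s', ∑ α, π 0 s a * (P 0 s a s' *
        (pathWeight (fun h => P h.succ) (fun h => π h.succ) s' σ α *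
          F (Fin.cons s σ) (Fin.cons a α))) :=
        Finset.sum_congr rfl fun σ _ => Finset.sum_comm
    _ = _ := Finset.sum_comm

lemma sum_pathWeight [DecidableEq S] {H : ℕ} (P : Fin H → S → A → S → ℝ)
    (hP : ∀ h s a, ∑ s', P h s a s' = 1) (π : Fin H → S → A → ℝ)
    (hπ : ∀ h s, ∑ a, π h s a = 1) (s : S) :
    ∑ σ, ∑ α, pathWeight P π s σ α = 1 := by
  induction H generalizing s with
  | zero =>
    rw [← (Equiv.funUnique (Fin 1) S).symm.sum_comp]
    simp [pathWeight]
  | succ H ih =>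
    have := sum_pathWeight_mul_succ P π s fun _ _ => 1
    simp only [mul_one] at this
    rw [this]
    simp [ih (fun h => P h.succ) (fun h => hP h.succ) (fun h => π h.succ) (fun h => hπ h.succ),
      hP, hπ]

lemma sum_pathWeight_mul_sum [DecidableEq S] {H : ℕ} (P : Fin H → S → A → S → ℝ)
    (hP : ∀ h s a, ∑ s', P h s a s' = 1) (π : Fin H → S → A → ℝ)
    (hπ : ∀ h s, ∑ a, π h s a = 1) (f : Fin H → S → A → ℝ) (s : S) :
    ∑ σ, ∑ α, pathWeight P π s σ α * ∑ h, f h (σ h.castSucc) (α h) = expectedTotal P π f s := by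
  induction H generalizing s with
  | zero => simp [expectedTotal]
  | succ H ih =>
    rw [sum_pathWeight_mul_succ P π s fun σ α => ∑ h, f h (σ h.castSucc) (α h)]
    simp only [Fin.sum_univ_succ, Fin.castSucc_zero, Fin.cons_zero, Fin.cons_succ,
      ← Fin.succ_castSucc, mul_add, Finset.sum_add_distrib,
      ih (fun h => P h.succ) (fun h => hP h.succ) (fun h => π h.succ) (fun h => hπ h.succ)
        (fun h => f h.succ)]
    simp only [← Finset.sum_mul, sum_pathWeight (fun h => P h.succ) (fun h => hP h.succ)
      (fun h => π h.succ) (fun h => hπ h.succ), one_mul, hP, expectedTotal, mul_add,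
      Finset.sum_add_distrib]

lemma value_eq_expectedTotal [DecidableEq S] {H : ℕ} (M : MDP S A H) {π : Fin H → S → A → ℝ}
    (hπ : IsPolicy π) (s : S) : value M π s = expectedTotal M.P π M.c s :=
  sum_pathWeight_mul_sum M.P M.P_sum π hπ.2 M.c s

/-- Only averages over the actions are compared, because the value estimate at a state is itself an
average of Q-estimates and no action-wise comparison is available. -/
lemma expectedTotal_mono {H : ℕ} {P : Fin H → S → A → S → ℝ} (hP : ∀ h s a s', 0 ≤ P h s a s')
    {π : Fin H → S → A → ℝ} (hπ : ∀ h s a, 0 ≤ π h s a) {f g : Fin H → S → A → ℝ}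
    (hfg : ∀ h s, ∑ a, π h s a * f h s a ≤ ∑ a, π h s a * g h s a) (s : S) :
    expectedTotal P π f s ≤ expectedTotal P π g s := by
  induction H generalizing s with
  | zero => simp [expectedTotal]
  | succ H ih =>
    simp only [expectedTotal, mul_add, Finset.sum_add_distrib]
    refine add_le_add (hfg 0 s) (Finset.sum_le_sum fun a _ =>
      mul_le_mul_of_nonneg_left (Finset.sum_le_sum fun s' _ =>
        mul_le_mul_of_nonneg_left ?_ (hP _ _ _ _)) (hπ _ _ _))
    exact ih (fun h => hP h.succ) (fun h => hπ h.succ) (fun h => hfg h.succ) s'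

lemma expectedTotal_congr {H : ℕ} {P : Fin H → S → A → S → ℝ} {π : Fin H → S → A → ℝ}
    {f g : Fin H → S → A → ℝ}
    (hfg : ∀ h s, ∑ a, π h s a * f h s a = ∑ a, π h s a * g h s a) (s : S) :
    expectedTotal P π f s = expectedTotal P π g s := by
  induction H generalizing s with
  | zero => simp [expectedTotal]
  | succ H ih =>
    simp only [expectedTotal, mul_add, Finset.sum_add_distrib, hfg 0 s]
    rw [funext fun s' => ih (P := fun h => P h.succ) (π := fun h => π h.succ)
      (f := fun h => f h.succ) (g := fun h => g h.succ) (fun h => hfg h.succ) s']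

lemma expectedTotal_add {H : ℕ} (P : Fin H → S → A → S → ℝ) (π f g : Fin H → S → A → ℝ) (s : S) :
    expectedTotal P π (fun h s a => f h s a + g h s a) s =
      expectedTotal P π f s + expectedTotal P π g s := by
  induction H generalizing s with
  | zero => simp [expectedTotal]
  | succ H ih =>
    simp only [expectedTotal, ih, mul_add, Finset.sum_add_distrib]
    ring

lemma expectedTotal_zero {H : ℕ} (P : Fin H → S → A → S → ℝ) (π : Fin H → S → A → ℝ) (s : S) :
    expectedTotal P π (fun _ _ _ => 0) s = 0 := by
  induction H generalizing s with
  | zero => simp [expectedTotal]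
  | succ H ih => simp [expectedTotal, ih]

lemma expectedTotal_neg {H : ℕ} (P : Fin H → S → A → S → ℝ) (π f : Fin H → S → A → ℝ) (s : S) :
    expectedTotal P π (fun h s a => - f h s a) s = - expectedTotal P π f s := by
  have := expectedTotal_add P π f (fun h s a => - f h s a) s
  simp only [add_neg_cancel, expectedTotal_zero] at this
  linarith

lemma expectedTotal_sub {H : ℕ} (P : Fin H → S → A → S → ℝ) (π f g : Fin H → S → A → ℝ) (s : S) :
    expectedTotal P π (fun h s a => f h s a - g h s a) s =
      expectedTotal P π f s - expectedTotal P π g s := by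
  simp only [sub_eq_add_neg]
  rw [expectedTotal_add P π f (fun h s a => - g h s a), expectedTotal_neg]

lemma expectedTotal_sum {ι : Type*} (t : Finset ι) {H : ℕ} (P : Fin H → S → A → S → ℝ)
    (π : Fin H → S → A → ℝ) (f : ι → Fin H → S → A → ℝ) (s : S) :
    expectedTotal P π (fun h s a => ∑ i ∈ t, f i h s a) s =
      ∑ i ∈ t, expectedTotal P π (f i) s := by
  classical
  induction t using Finset.induction_on with
  | empty => simp [expectedTotal_zero]
  | insert i t hi ih =>
    simp only [Finset.sum_insert hi]
    rw [expectedTotal_add P π (f i) (fun h s a => ∑ i ∈ t, f i h s a), ih]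

lemma expectedTotal_const {H : ℕ} {P : Fin H → S → A → S → ℝ}
    (hP : ∀ h s a, ∑ s', P h s a s' = 1) {π : Fin H → S → A → ℝ}
    (hπ : ∀ h s, ∑ a, π h s a = 1) (b : ℝ) (s : S) :
    expectedTotal P π (fun _ _ _ => b) s = H * b := by
  induction H generalizing s with
  | zero => simp [expectedTotal]
  | succ H ih =>
    simp only [expectedTotal, ih (P := fun h => P h.succ) (fun h => hP h.succ)
      (π := fun h => π h.succ) (fun h => hπ h.succ), ← Finset.sum_mul, hP, hπ]
    push_cast
    ring

/-- Telescoping of an arbitrary function of step and state along an episode. -/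
lemma expectedTotal_telescope {H : ℕ} {P : Fin H → S → A → S → ℝ} {π : Fin H → S → A → ℝ}
    (hπ : ∀ h s, ∑ a, π h s a = 1) (V : Fin (H + 1) → S → ℝ) (hV : ∀ s, V (Fin.last H) s = 0)
    (s : S) :
    expectedTotal P π (fun h s a => V h.castSucc s - ∑ s', P h s a s' * V h.succ s') s = V 0 s := by
  induction H generalizing s with
  | zero => simpa [expectedTotal] using (hV s).symm
  | succ H ih =>
    have key : ∀ s', expectedTotal (fun h => P h.succ) (fun h => π h.succ)
        (fun (h : Fin H) s a => V h.succ.castSucc s - ∑ s', P h.succ s a s' * V h.succ.succ s') s'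
          = V (Fin.succ 0) s' :=
      fun s' => ih (P := fun h => P h.succ) (π := fun h => π h.succ) (fun h => hπ h.succ)
        (fun h => V h.succ) (fun s => by simpa using hV s) s'
    simp only [expectedTotal, key]
    simp [← Finset.sum_mul, hπ]

end ExpectedTotal

/-! ### Deterministic analysis of the algorithm -/

section Deterministic

variable {S A : Type*} [Fintype S] [Fintype A] {H : ℕ}

lemma vEst_last (p : Params) (n : Counts S A H) (π : Fin H → S → A → ℝ) (s : S) :
    vEst p n π (Fin.last H) s = 0 := by
  simp [vEst]

lemma vEst_castSucc (p : Params) (n : Counts S A H) (π : Fin H → S → A → ℝ) (h : Fin H) (s : S) :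
    vEst p n π h.castSucc s = ∑ a, qEst p n π h s a * π h s a := by
  simp [vEst, qEst]

lemma qEst_nonneg (p : Params) (n : Counts S A H) (π : Fin H → S → A → ℝ) (h : Fin H) (s : S)
    (a : A) : 0 ≤ qEst p n π h s a := by
  have : ((h : ℕ) : ℝ) ≤ H := by exact_mod_cast h.2.le
  exact le_min (by linarith) (le_max_left _ _)

lemma qEst_le (p : Params) (n : Counts S A H) (π : Fin H → S → A → ℝ) (h : Fin H) (s : S)
    (a : A) : qEst p n π h s a ≤ (H : ℝ) - (h : ℕ) := min_le_left _ _

lemma vEst_nonneg (p : Params) (n : Counts S A H) {π : Fin H → S → A → ℝ} (hπ : IsPolicy π)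
    (i : Fin (H + 1)) (s : S) : 0 ≤ vEst p n π i s := by
  cases i using Fin.lastCases with
  | last => rw [vEst_last]
  | cast h =>
    rw [vEst_castSucc]
    exact Finset.sum_nonneg fun a _ => mul_nonneg (qEst_nonneg _ _ _ _ _ _) (hπ.1 _ _ _)

lemma vEst_le (p : Params) (n : Counts S A H) {π : Fin H → S → A → ℝ} (hπ : IsPolicy π)
    (i : Fin (H + 1)) (s : S) : vEst p n π i s ≤ (H : ℝ) - (i : ℕ) := by
  cases i using Fin.lastCases with
  | last => rw [vEst_last]; simp
  | cast h =>
    rw [vEst_castSucc]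
    calc _ ≤ ∑ a, ((H : ℝ) - (h : ℕ)) * π h s a :=
          Finset.sum_le_sum fun a _ => mul_le_mul_of_nonneg_right (qEst_le _ _ _ _ _ _) (hπ.1 _ _ _)
      _ = _ := by rw [← Finset.mul_sum, hπ.2]; simp

/-! ### Exponential weights and the regret decomposition -/

lemma policy_pos [Nonempty A] (p : Params) (n : ℕ → Counts S A H) (k : ℕ) (h : Fin H) (s : S)
    (a : A) : 0 < policy p n k h s a := by
  induction k generalizing h s a with
  | zero => simp only [policy]; positivity
  | succ k ih =>
    simp only [policy]
    exact div_pos (mul_pos (ih _ _ _) (Real.exp_pos _))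
      (Finset.sum_pos (fun b _ => mul_pos (ih _ _ _) (Real.exp_pos _)) Finset.univ_nonempty)

lemma isPolicy_policy [Nonempty A] (p : Params) (n : ℕ → Counts S A H) (k : ℕ) :
    IsPolicy (policy p n k) := by
  refine ⟨fun h s a => (policy_pos p n k h s a).le, fun h s => ?_⟩
  cases k with
  | zero => simp [policy]
  | succ k =>
    simp only [policy]
    rw [← Finset.sum_div]
    exact div_self (Finset.sum_pos (fun b _ => mul_pos (policy_pos _ _ _ _ _ _) (Real.exp_pos _))
      Finset.univ_nonempty).ne'

/-- Follows from exp x ≥ 1 + x + x²/2 and (1 − x + x²/2)(1 + x + x²/2) = 1 + x⁴/4 ≥ 1. -/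
lemma exp_neg_le_quadratic {x : ℝ} (hx : 0 ≤ x) : Real.exp (-x) ≤ 1 - x + x ^ 2 / 2 := by
  have h1 : 1 + x + x ^ 2 / 2 ≤ Real.exp x := Real.quadratic_le_exp_of_nonneg hx
  rw [Real.exp_neg, inv_eq_one_div, div_le_iff₀ (Real.exp_pos _)]
  have h2 : 0 ≤ 1 - x + x ^ 2 / 2 := by nlinarith [sq_nonneg (x - 1)]
  nlinarith [mul_le_mul_of_nonneg_left h1 h2, sq_nonneg (x ^ 2)]

/-- One step of exponential weights. -/
lemma exp_weights_step {w q : A → ℝ} (hw : ∀ a, 0 < w a) (hw1 : ∑ a, w a = 1) {η B : ℝ}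
    (hη : 0 ≤ η) (hq : ∀ a, 0 ≤ q a) (hqB : ∀ a, q a ≤ B) (a : A) :
    η * (∑ b, w b * q b - q a) ≤ η ^ 2 * B ^ 2 / 2 +
      (Real.log (w a * Real.exp (-η * q a) / ∑ b, w b * Real.exp (-η * q b)) -
        Real.log (w a)) := by
  have hZ : 0 < ∑ b, w b * Real.exp (-η * q b) :=
    Finset.sum_pos (fun b _ => mul_pos (hw b) (Real.exp_pos _)) ⟨a, Finset.mem_univ a⟩
  rw [Real.log_div (mul_pos (hw a) (Real.exp_pos _)).ne' hZ.ne',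
    Real.log_mul (hw a).ne' (Real.exp_pos _).ne', Real.log_exp]
  -- The log-ratio of the weights is −η q(a) − log Z, so an upper bound on log Z, to second order in
  -- η, is all that is needed.
  have h1 : Real.log (∑ b, w b * Real.exp (-η * q b)) ≤
      (∑ b, w b * Real.exp (-η * q b)) - 1 := Real.log_le_sub_one_of_pos hZ
  have h2 : ∑ b, w b * Real.exp (-η * q b) ≤
      ∑ b, (w b - η * (w b * q b) + w b * (η ^ 2 * B ^ 2 / 2)) := by
    refine Finset.sum_le_sum fun b _ => ?_
    have h3 := exp_neg_le_quadratic (mul_nonneg hη (hq b))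
    have h4 : (η * q b) ^ 2 ≤ η ^ 2 * B ^ 2 := by
      rw [mul_pow]
      exact mul_le_mul_of_nonneg_left (pow_le_pow_left₀ (hq b) (hqB b) 2) (sq_nonneg _)
    rw [neg_mul]
    calc w b * Real.exp (-(η * q b)) ≤ w b * (1 - η * q b + η ^ 2 * B ^ 2 / 2) :=
          mul_le_mul_of_nonneg_left (by linarith) (hw b).le
      _ = _ := by ring
  rw [Finset.sum_add_distrib, Finset.sum_sub_distrib, ← Finset.mul_sum, ← Finset.sum_mul,
    hw1] at h2
  linarith

/-- Regret of the policy updates against a fixed action. -/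
lemma policy_regret_le [Nonempty A] (p : Params) (hK : 0 < p.K) (hH : 0 < H)
    (hη : p.η = Real.sqrt (2 * Real.log (Fintype.card A) / ((H : ℝ) ^ 2 * p.K)))
    (n : ℕ → Counts S A H) (h : Fin H) (s : S) (a : A) :
    ∑ k ∈ Finset.range p.K, (∑ b, policy p n k h s b * qEst p (n k) (policy p n k) h s b
        - qEst p (n k) (policy p n k) h s a) ≤
      Real.sqrt (2 * (H : ℝ) ^ 2 * p.K * Real.log (Fintype.card A)) := by
  have hA : 1 ≤ Fintype.card A := Fintype.card_pos
  have hK' : (0 : ℝ) < p.K := by exact_mod_cast hK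
  have hH' : (0 : ℝ) < H := by exact_mod_cast hH
  -- With one action the step size is 0 and cannot be divided by, but then the regret vanishes.
  rcases hA.eq_or_lt with hA1 | hA1
  · obtain ⟨x, hx⟩ := Fintype.card_eq_one_iff.mp hA1.symm
    refine (Finset.sum_nonpos fun k _ => ?_).trans (Real.sqrt_nonneg _)
    have h1 : ∑ b, policy p n k h s b * qEst p (n k) (policy p n k) h s b =
        ∑ b, policy p n k h s b * qEst p (n k) (policy p n k) h s a :=
      Finset.sum_congr rfl fun b _ => by rw [hx b, hx a]
    rw [h1, ← Finset.sum_mul, (isPolicy_policy p n k).2]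
    simp
  · have hlog : 0 < Real.log (Fintype.card A) := Real.log_pos (by exact_mod_cast hA1)
    have hη0 : 0 < p.η := by rw [hη]; positivity
    have hη2 : p.η ^ 2 = 2 * Real.log (Fintype.card A) / ((H : ℝ) ^ 2 * p.K) := by
      rw [hη, Real.sq_sqrt (by positivity)]
    have step : ∀ k, p.η * (∑ b, policy p n k h s b * qEst p (n k) (policy p n k) h s b
        - qEst p (n k) (policy p n k) h s a) ≤ p.η ^ 2 * (H : ℝ) ^ 2 / 2 +
        (Real.log (policy p n (k + 1) h s a) - Real.log (policy p n k h s a)) := fun k =>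
      exp_weights_step (fun a => policy_pos p n k h s a) ((isPolicy_policy p n k).2 h s) hη0.le
        (fun b => qEst_nonneg _ _ _ _ _ _)
        (fun b => (qEst_le _ _ _ _ _ _).trans (by
          have : (0 : ℝ) ≤ (h : ℕ) := Nat.cast_nonneg _
          linarith)) a
    have hsum := Finset.sum_le_sum fun k (_ : k ∈ Finset.range p.K) => step k
    rw [← Finset.mul_sum, Finset.sum_add_distrib,
      Finset.sum_range_sub (fun k => Real.log (policy p n k h s a))] at hsum
    -- The log-weights telescope from −log A, for the uniform policy, to at most 0.
    have h0 : Real.log (policy p n 0 h s a) = - Real.log (Fintype.card A) := by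
      simp [policy]
    have hle : Real.log (policy p n p.K h s a) ≤ 0 := by
      refine Real.log_nonpos (policy_pos _ _ _ _ _ _).le ?_
      rw [← (isPolicy_policy p n p.K).2 h s]
      exact Finset.single_le_sum (fun b _ => (policy_pos p n p.K h s b).le) (Finset.mem_univ a)
    simp only [Finset.sum_const, Finset.card_range, nsmul_eq_mul] at hsum
    -- The step size balances the two contributions: the second-order terms also add up to log A.
    have hmid : (p.K : ℝ) * (p.η ^ 2 * (H : ℝ) ^ 2 / 2) = Real.log (Fintype.card A) := by
      rw [hη2]; field_simp
    rw [hmid, h0] at hsum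
    have hfin : p.η * Real.sqrt (2 * (H : ℝ) ^ 2 * p.K * Real.log (Fintype.card A)) =
        2 * Real.log (Fintype.card A) := by
      rw [hη, ← Real.sqrt_mul (by positivity)]
      rw [show 2 * Real.log (Fintype.card A) / ((H : ℝ) ^ 2 * p.K) *
        (2 * (H : ℝ) ^ 2 * p.K * Real.log (Fintype.card A)) =
          (2 * Real.log (Fintype.card A)) ^ 2 by field_simp]
      exact Real.sqrt_sq (by positivity)
    refine le_of_mul_le_mul_left ?_ hη0
    rw [hfin]
    linarith

/-- Regret decomposition: the private `Q`-estimates are optimistic up to an error `g`. -/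
lemma sum_value_sub_le [DecidableEq S] [Nonempty A] (M : MDP S A H) (p : Params) (hK : 0 < p.K)
    (hH : 0 < H)
    (hη : p.η = Real.sqrt (2 * Real.log (Fintype.card A) / ((H : ℝ) ^ 2 * p.K)))
    (n : ℕ → Counts S A H) (g : ℕ → Fin H → S → A → ℝ)
    (hopt : ∀ k < p.K, ∀ h s a, qEst p (n k) (policy p n k) h s a ≤
      M.c h s a + ∑ s', M.P h s a s' * vEst p (n k) (policy p n k) h.succ s')
    (hpess : ∀ k < p.K, ∀ h s a,
      M.c h s a + ∑ s', M.P h s a s' * vEst p (n k) (policy p n k) h.succ s' -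
        qEst p (n k) (policy p n k) h s a ≤ g k h s a)
    {ρ : Fin H → S → A → ℝ} (hρ : IsPolicy ρ) (s : S) :
    ∑ k ∈ Finset.range p.K, (value M (policy p n k) s - value M ρ s) ≤
      H * Real.sqrt (2 * (H : ℝ) ^ 2 * p.K * Real.log (Fintype.card A)) +
      ∑ k ∈ Finset.range p.K, expectedTotal M.P (policy p n k) (g k) s := by
  have h1 : ∀ k < p.K, value M (policy p n k) s ≤ vEst p (n k) (policy p n k) 0 s +
      expectedTotal M.P (policy p n k) (g k) s := by
    intro k hk
    have hp := isPolicy_policy p n k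
    rw [value_eq_expectedTotal M hp,
      ← expectedTotal_telescope (P := M.P) hp.2 _ (vEst_last p (n k) (policy p n k)) s,
      ← expectedTotal_add]
    refine expectedTotal_mono M.P_nonneg hp.1 (fun h s => ?_) s
    simp only [mul_add, mul_sub, Finset.sum_add_distrib, Finset.sum_sub_distrib]
    rw [← Finset.sum_mul, hp.2, one_mul, vEst_castSucc]
    have := Finset.sum_le_sum fun a (_ : a ∈ Finset.univ) =>
      mul_le_mul_of_nonneg_left (hpess k hk h s a) (hp.1 h s a)
    simp only [mul_add, mul_sub, Finset.sum_add_distrib, Finset.sum_sub_distrib] at this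
    simp only [mul_comm (qEst _ _ _ _ _ _)]
    linarith
  have h2 : ∑ k ∈ Finset.range p.K, (vEst p (n k) (policy p n k) 0 s - value M ρ s) ≤
      H * Real.sqrt (2 * (H : ℝ) ^ 2 * p.K * Real.log (Fintype.card A)) := by
    have h3 : ∀ k < p.K, vEst p (n k) (policy p n k) 0 s - value M ρ s ≤
        expectedTotal M.P ρ (fun h s a =>
          ∑ b, policy p n k h s b * qEst p (n k) (policy p n k) h s b
            - qEst p (n k) (policy p n k) h s a) s := by
      intro k hk
      rw [value_eq_expectedTotal M hρ,
        ← expectedTotal_telescope (P := M.P) hρ.2 _ (vEst_last p (n k) (policy p n k)) s,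
        ← expectedTotal_sub]
      refine expectedTotal_mono M.P_nonneg hρ.1 (fun h s => Finset.sum_le_sum fun a _ =>
        mul_le_mul_of_nonneg_left ?_ (hρ.1 h s a)) s
      have := hopt k hk h s a
      rw [vEst_castSucc]
      simp only [mul_comm (qEst _ _ _ _ _ _)]
      linarith
    refine (Finset.sum_le_sum fun k hk => h3 k (Finset.mem_range.1 hk)).trans ?_
    -- The trajectory law of `ρ` is the same in all episodes, so the sum over episodes moves inside
    -- the expectation and meets the exponential-weights bound pointwise.
    rw [← expectedTotal_sum, ← expectedTotal_const M.P_sum hρ.2]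
    exact expectedTotal_mono M.P_nonneg hρ.1 (fun h s => Finset.sum_le_sum fun a _ =>
      mul_le_mul_of_nonneg_left (policy_regret_le p hK hH hη n h s a) (hρ.1 h s a)) s
  have h4 := Finset.sum_le_sum fun k hk => h1 k (Finset.mem_range.1 hk)
  rw [Finset.sum_add_distrib] at h4
  rw [Finset.sum_sub_distrib] at h2 ⊢
  linarith

/-- No optimal policy has to exist: divided by K, the bound uniform in `ρ` is a lower bound for all
values, hence for their infimum. -/
lemma regret_le [DecidableEq S] [Nonempty A] {Ω : Type*} (M : MDP S A H) (p : Params)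
    (hK : 0 < p.K) (X : Interaction S A H Ω) (ω : Ω) (s : S) {b : ℝ}
    (hb : ∀ ρ : Fin H → S → A → ℝ, IsPolicy ρ →
      ∑ k ∈ Finset.range p.K, (value M (policy p (X.counts ω) k) s - value M ρ s) ≤ b) :
    regret M s p X ω ≤ b := by
  have hK' : (0 : ℝ) < p.K := by exact_mod_cast hK
  have : Nonempty {π : Fin H → S → A → ℝ // IsPolicy π} :=
    ⟨⟨_, isPolicy_policy p (X.counts ω) 0⟩⟩
  have h1 : (∑ k ∈ Finset.range p.K, value M (policy p (X.counts ω) k) s - b) / p.K ≤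
      optValue M s := by
    refine le_ciInf fun ρ => ?_
    have := hb ρ.1 ρ.2
    rw [Finset.sum_sub_distrib] at this
    simp only [Finset.sum_const, Finset.card_range, nsmul_eq_mul] at this
    rw [div_le_iff₀ hK']
    linarith
  rw [div_le_iff₀ hK'] at h1
  rw [regret, Finset.sum_sub_distrib]
  simp only [Finset.sum_const, Finset.card_range, nsmul_eq_mul]
  linarith

/-! ### Optimism and accuracy of the private estimates -/

/-- For N ≥ 1 the truncation at 1 is inactive and N ≤ D ≤ N + 2E. For N = 0 the truncation may move
D to 1; that error is paid by L√D, as no sampling error occurs then and L ≥ 1. Hence the dichotomy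
for N and the lower bound on L. -/
lemma abs_sub_add_le_of_count {N Nt E L D : ℝ} (hN : N = 0 ∨ 1 ≤ N) (hNt : |Nt - N| ≤ E)
    (hL : 1 ≤ L) (hD : D = max 1 (Nt + E)) :
    |N - D| + L * Real.sqrt N ≤ L * Real.sqrt D + 2 * E := by
  have hNt' := abs_le.1 hNt
  have hE : 0 ≤ E := (abs_nonneg _).trans hNt
  rcases hN with rfl | hN
  · simp only [Real.sqrt_zero, mul_zero, add_zero, zero_sub, abs_neg]
    rcases max_choice 1 (Nt + E) with h | h
    · rw [h] at hD
      subst hD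
      simp only [abs_one, Real.sqrt_one]
      linarith
    · rw [h] at hD
      have : 1 ≤ D := by rw [hD, ← h]; exact le_max_left _ _
      rw [abs_of_nonneg (by linarith)]
      have := mul_nonneg (by linarith : 0 ≤ L) (Real.sqrt_nonneg D)
      linarith
  · rw [max_eq_right (by linarith)] at hD
    have h1 : |N - D| ≤ 2 * E := abs_le.2 ⟨by linarith, by linarith⟩
    have h2 : Real.sqrt N ≤ Real.sqrt D := Real.sqrt_le_sqrt (by linarith)
    nlinarith

omit [Fintype S] [Fintype A] in
lemma le_den {p : Params} {n : Counts S A H} {h : Fin H} {s : S} {a : A} {N : ℝ}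
    (hNt : |n.N h s a - N| ≤ p.E₁) : max 1 N ≤ den p n h s a := by
  have := abs_le.1 hNt
  exact max_le_max le_rfl (by linarith)

omit [Fintype S] [Fintype A] in
lemma one_le_den (p : Params) (n : Counts S A H) (h : Fin H) (s : S) (a : A) :
    1 ≤ den p n h s a := le_max_left _ _

lemma mul_sqrt_div_eq (L D : ℝ) : L * Real.sqrt D / D = L / Real.sqrt D := by
  rw [mul_div_assoc, Real.sqrt_div_self', mul_one_div]

/-- Three errors over the common denominator: release of the cost (E₁), sampling, and release of the
denominator (2E₁). The last two are bounded together by the preceding lemma, which explains the 3E₁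
in the bonus. -/
lemma abs_costEst_sub_le {p : Params} {n : Counts S A H} {h : Fin H} {s : S} {a : A} {N C c : ℝ}
    (hN : N = 0 ∨ 1 ≤ N) (hNt : |n.N h s a - N| ≤ p.E₁) (hC : |n.C h s a - C| ≤ p.E₁)
    (hL : 1 ≤ Lc S A H p) (hconc : |C - N * c| ≤ Lc S A H p * Real.sqrt N)
    (hc : 0 ≤ c) (hc1 : c ≤ 1) : |costEst p n h s a - c| ≤ bonusC p n h s a := by
  have hD := one_le_den p n h s a
  have hD0 : 0 < den p n h s a := by linarith
  have key := abs_sub_add_le_of_count hN hNt hL (D := den p n h s a) rfl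
  rw [costEst, bonusC, ← mul_sqrt_div_eq, ← add_div]
  rw [show n.C h s a / den p n h s a - c =
    ((n.C h s a - C) + (C - N * c) + (N - den p n h s a) * c) / den p n h s a by
      field_simp; ring]
  rw [abs_div, abs_of_pos hD0]
  refine div_le_div_of_nonneg_right ?_ hD0.le
  have h1 : |(N - den p n h s a) * c| ≤ |N - den p n h s a| := by
    rw [abs_mul, abs_of_nonneg hc]
    exact mul_le_of_le_one_right (abs_nonneg _) hc1
  have := abs_add_three (n.C h s a - C) (C - N * c) ((N - den p n h s a) * c)
  linarith

/-- For V ≥ 0 the sum is at most b times the mass of the positive part of d, a subset sum. As d has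
total mass 0, its negative part has the same mass, so upper bounds on subset sums serve both
directions. -/
lemma abs_sum_mul_le_of_subset_sums {d V : S → ℝ} {b t : ℝ} (hd : ∑ s, d s = 0)
    (hV : ∀ s, 0 ≤ V s) (hVb : ∀ s, V s ≤ b) (hb : 0 ≤ b)
    (hB : ∀ B : Finset S, ∑ s ∈ B, d s ≤ t) : |∑ s, V s * d s| ≤ b * t := by
  classical
  have main : ∀ d : S → ℝ, (∑ s with 0 ≤ d s, d s ≤ t) → ∑ s, V s * d s ≤ b * t := by
    intro d hd
    calc ∑ s, V s * d s ≤ ∑ s, (if 0 ≤ d s then b * d s else 0) := by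
          refine Finset.sum_le_sum fun s _ => ?_
          split_ifs with h
          · exact mul_le_mul_of_nonneg_right (hVb s) h
          · exact mul_nonpos_of_nonneg_of_nonpos (hV s) (le_of_not_ge h)
      _ = b * ∑ s with 0 ≤ d s, d s := by
          rw [Finset.mul_sum, Finset.sum_filter]
      _ ≤ b * t := mul_le_mul_of_nonneg_left hd hb
  rw [abs_le]
  constructor
  · have := main (fun s => - d s) (by
      have h1 := hB (Finset.univ.filter fun s => ¬ 0 ≤ - d s)
      have h2 := Finset.sum_filter_add_sum_filter_not Finset.univ (fun s => 0 ≤ - d s) d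
      rw [Finset.sum_neg_distrib]
      linarith)
    simp only [mul_neg, Finset.sum_neg_distrib] at this
    linarith
  · exact main d (hB _)

/-- The concentration hypothesis does not mention `V`, so `V` may be the value estimate computed
from the same data. -/
lemma abs_transEst_sub_le {p : Params} {n : Counts S A H} {h : Fin H} {s : S} {a : A} {N : ℝ}
    {NS P V : S → ℝ} (hN : N = 0 ∨ 1 ≤ N) (hNt : |n.N h s a - N| ≤ p.E₁)
    (hNS : ∀ s', |n.NS h s a s' - NS s'| ≤ p.E₂) (hsum : ∑ s', NS s' = N)
    (hP : ∀ s', 0 ≤ P s') (hP1 : ∑ s', P s' = 1) (hV : ∀ s', 0 ≤ V s') (hVH : ∀ s', V s' ≤ H)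
    (hL : 1 ≤ Lp S A H p)
    (hconc : ∀ B : Finset S, ∑ s' ∈ B, (NS s' - N * P s') ≤ Lp S A H p * Real.sqrt N) :
    |∑ s', V s' * transEst p n h s a s' - ∑ s', P s' * V s'| ≤ H * bonusP p n h s a := by
  have hD := one_le_den p n h s a
  have hD0 : 0 < den p n h s a := by linarith
  have hH0 : (0 : ℝ) ≤ H := Nat.cast_nonneg _
  have key := abs_sub_add_le_of_count hN hNt hL (D := den p n h s a) rfl
  rw [bonusP, ← mul_sqrt_div_eq, ← add_div, ← mul_div_assoc]
  have heq : ∑ s', V s' * transEst p n h s a s' - ∑ s', P s' * V s' =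
      (∑ s', V s' * (n.NS h s a s' - NS s') + ∑ s', V s' * (NS s' - N * P s') +
        (N - den p n h s a) * ∑ s', P s' * V s') / den p n h s a := by
    rw [Finset.mul_sum, ← Finset.sum_add_distrib, ← Finset.sum_add_distrib, Finset.sum_div,
      ← Finset.sum_sub_distrib]
    refine Finset.sum_congr rfl fun s' _ => ?_
    rw [transEst]
    field_simp
    ring
  rw [heq, abs_div, abs_of_pos hD0]
  refine div_le_div_of_nonneg_right ?_ hD0.le
  have h1 : |∑ s', V s' * (n.NS h s a s' - NS s')| ≤ H * (Fintype.card S * p.E₂) := by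
    refine (Finset.abs_sum_le_sum_abs _ _).trans ?_
    calc _ ≤ ∑ _s' : S, (H : ℝ) * p.E₂ := Finset.sum_le_sum fun s' _ => by
          rw [abs_mul, abs_of_nonneg (hV s')]
          exact mul_le_mul (hVH s') (hNS s') (abs_nonneg _) hH0
      _ = _ := by simp; ring
  have h2 : |∑ s', V s' * (NS s' - N * P s')| ≤ H * (Lp S A H p * Real.sqrt N) :=
    abs_sum_mul_le_of_subset_sums (by
      rw [Finset.sum_sub_distrib, ← Finset.mul_sum, hsum, hP1]; ring) hV hVH hH0 hconc
  have h3 : |(N - den p n h s a) * ∑ s', P s' * V s'| ≤ H * |N - den p n h s a| := by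
    have h4 : 0 ≤ ∑ s', P s' * V s' := Finset.sum_nonneg fun s' _ => mul_nonneg (hP s') (hV s')
    have h5 : ∑ s', P s' * V s' ≤ H := by
      calc _ ≤ ∑ s', P s' * H :=
            Finset.sum_le_sum fun s' _ => mul_le_mul_of_nonneg_left (hVH s') (hP s')
        _ = H := by rw [← Finset.sum_mul, hP1, one_mul]
    rw [abs_mul, abs_of_nonneg h4, mul_comm]
    exact mul_le_mul_of_nonneg_right h5 (abs_nonneg _)
  have := abs_add_three (∑ s', V s' * (n.NS h s a s' - NS s')) (∑ s', V s' * (NS s' - N * P s'))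
    ((N - den p n h s a) * ∑ s', P s' * V s')
  have h6 := mul_le_mul_of_nonneg_left key hH0
  simp only [mul_add] at h6 ⊢
  linarith

lemma bonus_nonneg {p : Params} (h₁ : 0 ≤ p.E₁) (h₂ : 0 ≤ p.E₂) (n : Counts S A H) (h : Fin H)
    (s : S) (a : A) : 0 ≤ bonus p n h s a := by
  have hD : 0 < den p n h s a := zero_lt_one.trans_le (one_le_den p n h s a)
  have hc : 0 ≤ Lc S A H p := Real.sqrt_nonneg _
  have hp : 0 ≤ Lp S A H p := Real.sqrt_nonneg _
  unfold bonus bonusC bonusP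
  positivity

lemma qEst_optimistic (M : MDP S A H) {p : Params} {n : Counts S A H} {π : Fin H → S → A → ℝ}
    (hπ : IsPolicy π) {h : Fin H} {s : S} {a : A}
    (hc : |costEst p n h s a - M.c h s a| ≤ bonusC p n h s a)
    (hp : |∑ s', vEst p n π h.succ s' * transEst p n h s a s' -
      ∑ s', M.P h s a s' * vEst p n π h.succ s'| ≤ H * bonusP p n h s a) :
    qEst p n π h s a ≤ M.c h s a + ∑ s', M.P h s a s' * vEst p n π h.succ s' := by
  have h0 : 0 ≤ ∑ s', M.P h s a s' * vEst p n π h.succ s' :=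
    Finset.sum_nonneg fun s' _ => mul_nonneg (M.P_nonneg _ _ _ _) (vEst_nonneg p n hπ _ _)
  have h1 := M.c_nonneg h s a
  have hc' := abs_le.1 hc
  have hp' := abs_le.1 hp
  -- Truncation from below is harmless since the right-hand side is nonnegative.
  refine (min_le_right _ _).trans (max_le (by linarith) ?_)
  rw [bonus]
  linarith

/-- The bonus is lost twice, once as estimation error and once as the amount subtracted. The
alternative bound H keeps the error bounded for the later martingale argument. -/
lemma qEst_pessimistic (M : MDP S A H) {p : Params} {n : Counts S A H} {π : Fin H → S → A → ℝ}
    (hπ : IsPolicy π) {h : Fin H} {s : S} {a : A}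
    (hc : |costEst p n h s a - M.c h s a| ≤ bonusC p n h s a)
    (hp : |∑ s', vEst p n π h.succ s' * transEst p n h s a s' -
      ∑ s', M.P h s a s' * vEst p n π h.succ s'| ≤ H * bonusP p n h s a) :
    M.c h s a + ∑ s', M.P h s a s' * vEst p n π h.succ s' - qEst p n π h s a ≤
      min (2 * bonus p n h s a) H := by
  have hc' := abs_le.1 hc
  have hp' := abs_le.1 hp
  -- One unit of cost now plus at most H − h − 1 later: truncation from above therefore does not
  -- worsen the error.
  have h1 : M.c h s a + ∑ s', M.P h s a s' * vEst p n π h.succ s' ≤ (H : ℝ) - (h : ℕ) := by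
    calc _ ≤ 1 + ∑ s', M.P h s a s' * ((H : ℝ) - (h.succ : ℕ)) :=
          add_le_add (M.c_le_one _ _ _) (Finset.sum_le_sum fun s' _ =>
            mul_le_mul_of_nonneg_left (vEst_le p n hπ _ _) (M.P_nonneg _ _ _ _))
      _ = _ := by rw [← Finset.sum_mul, M.P_sum]; simp; ring
  have hβ : 0 ≤ bonus p n h s a :=
    add_nonneg ((abs_nonneg _).trans hc) ((abs_nonneg _).trans hp)
  refine le_min ?_ ?_
  · have : M.c h s a + ∑ s', M.P h s a s' * vEst p n π h.succ s' - 2 * bonus p n h s a ≤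
        qEst p n π h s a := by
      refine le_min (by linarith) (le_max_of_le_right ?_)
      rw [bonus]
      linarith
    linarith
  · have h2 := qEst_nonneg p n π h s a
    have h3 : (0 : ℝ) ≤ (h : ℕ) := Nat.cast_nonneg _
    linarith

end Deterministic

/-! ### A concentration inequality for sums of bounded martingale differences -/

section Azuma

/-- Convexity of exp on the chord between −l and l. The bound is affine in x, so a centred x
contributes only cosh l. -/
lemma exp_mul_le_cosh_add_mul_sinh {x : ℝ} (hx : |x| ≤ 1) (l : ℝ) :
    Real.exp (l * x) ≤ Real.cosh l + x * Real.sinh l := by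
  have hx' := abs_le.1 hx
  have h := convexOn_exp.2 (Set.mem_univ l) (Set.mem_univ (-l))
    (by linarith : 0 ≤ (1 + x) / 2) (by linarith : 0 ≤ (1 - x) / 2) (by ring)
  simp only [smul_eq_mul] at h
  rw [show (1 + x) / 2 * l + (1 - x) / 2 * -l = l * x by ring] at h
  rw [Real.cosh_eq, Real.sinh_eq]
  linarith

variable {Ω : Type*} {m0 : MeasurableSpace Ω} {μ : Measure Ω} [IsProbabilityMeasure μ]

/-- Azuma's inequality for differences that vanish outside predictable events `v j = 1` at most
`n` of which occur. -/
lemma measure_sum_ge_le_of_orthogonal {K : ℕ} {G : ℕ → MeasurableSpace Ω} {v Y : ℕ → Ω → ℝ}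
    (hG : ∀ j < K, G j ≤ m0)
    (hv : ∀ j < K, Measurable[G j] (v j)) (hv01 : ∀ j ω, v j ω = 0 ∨ v j ω = 1)
    (hvpast : ∀ j < K, ∀ i < j, Measurable[G j] (v i))
    (hYpast : ∀ j < K, ∀ i < j, Measurable[G j] (Y i))
    (hY : ∀ j < K, Measurable (Y j)) (hYv : ∀ j < K, ∀ᵐ ω ∂μ, |Y j ω| ≤ v j ω)
    (horth : ∀ j < K, ∀ Z : Ω → ℝ, Measurable[G j] Z → (∃ b, ∀ᵐ ω ∂μ, |Z ω| ≤ b) →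
      ∫ ω, Z ω * Y j ω ∂μ = 0)
    {n t : ℝ} (hn : 0 < n) (ht : 0 ≤ t) (hvn : ∀ ω, ∑ j ∈ Finset.range K, v j ω ≤ n) :
    μ.real {ω | t ≤ ∑ j ∈ Finset.range K, Y j ω} ≤ Real.exp (-(t ^ 2 / (2 * n))) := by
  -- The minimizer of l²n/2 − lt.
  set l : ℝ := t / n with hl
  have hl0 : 0 ≤ l := div_nonneg ht hn.le
  -- The exponential process, compensated only at the indices with `v` equal to 1; its expectation
  -- will be shown not to increase.
  set W : ℕ → Ω → ℝ := fun m ω =>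
    Real.exp (∑ i ∈ Finset.range m, (l * Y i ω - l ^ 2 / 2 * v i ω)) with hW
  have hWm : ∀ m ≤ K, Measurable (W m) := by
    intro m hm
    refine Real.measurable_exp.comp (Finset.measurable_sum _ fun i hi => ?_)
    have hi' : i < K := (Finset.mem_range.1 hi).trans_le hm
    exact ((hY i hi').const_mul _).sub (((hv i hi').mono (hG i hi') le_rfl).const_mul _)
  have hWG : ∀ m < K, Measurable[G m] (W m) := by
    intro m hm
    refine Real.measurable_exp.comp (Finset.measurable_sum _ fun i hi => ?_)
    have hi' : i < m := Finset.mem_range.1 hi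
    exact ((hYpast m hm i hi').const_mul _).sub ((hvpast m hm i hi').const_mul _)
  have hWb : ∀ m ≤ K, ∀ᵐ ω ∂μ, |W m ω| ≤ Real.exp (m * l) := by
    intro m hm
    have : ∀ᵐ ω ∂μ, ∀ i ∈ Finset.range m, |Y i ω| ≤ v i ω :=
      (Filter.eventually_all_finset _).2 fun i hi => hYv i ((Finset.mem_range.1 hi).trans_le hm)
    filter_upwards [this] with ω hω
    rw [abs_of_pos (Real.exp_pos _)]
    refine Real.exp_le_exp.2 ?_
    calc _ ≤ ∑ _i ∈ Finset.range m, l := Finset.sum_le_sum fun i hi => by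
          have h1 := (abs_le.1 (hω i hi)).2
          rcases hv01 i ω with h | h
          · rw [h] at h1 ⊢
            nlinarith
          · rw [h] at h1 ⊢
            nlinarith [sq_nonneg l]
      _ = _ := by simp
  have hWi : ∀ m ≤ K, Integrable (W m) μ := fun m hm =>
    Integrable.of_bound (hWm m hm).aestronglyMeasurable (Real.exp (m * l)) (hWb m hm)
  have hstep : ∀ m ≤ K, ∫ ω, W m ω ∂μ ≤ 1 := by
    intro m
    induction m with
    | zero => simp [hW]
    | succ m ih =>
      intro hm
      have hm' : m < K := hm
      refine le_trans ?_ (ih hm'.le)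
      -- The new factor of `W` is at most 1 + κ Y, with equality where `v` vanishes, and the term κ
      -- W Y integrates to 0 because `W` is bounded and measurable for the past.
      set κ : ℝ := Real.exp (-(l ^ 2 / 2)) * Real.sinh l
      have hWYi : Integrable (fun ω => W m ω * Y m ω) μ := by
        refine Integrable.of_bound ((hWm m hm'.le).mul (hY m hm')).aestronglyMeasurable
          (Real.exp (m * l) * 1) ?_
        filter_upwards [hWb m hm'.le, hYv m hm'] with ω h1 h2
        rw [norm_mul, Real.norm_eq_abs, Real.norm_eq_abs]
        refine mul_le_mul h1 (h2.trans ?_) (abs_nonneg _) (Real.exp_pos _).le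
        rcases hv01 m ω with h | h <;> simp [h]
      have hle : ∫ ω, W (m + 1) ω ∂μ ≤ ∫ ω, (W m ω + κ * (W m ω * Y m ω)) ∂μ := by
        refine integral_mono_ae (hWi _ hm) ((hWi _ hm'.le).add (hWYi.const_mul κ)) ?_
        filter_upwards [hYv m hm'] with ω h2
        have h3 : W (m + 1) ω = W m ω * Real.exp (l * Y m ω - l ^ 2 / 2 * v m ω) := by
          simp only [hW, Finset.sum_range_succ, Real.exp_add]
        have h4 : Real.exp (l * Y m ω - l ^ 2 / 2 * v m ω) ≤ 1 + κ * Y m ω := by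
          rcases hv01 m ω with h | h
          · rw [h, abs_le] at h2
            have : Y m ω = 0 := by linarith [h2.1, h2.2]
            simp [h, this]
          · rw [h] at h2 ⊢
            rw [mul_one, sub_eq_add_neg, Real.exp_add, mul_comm]
            have h5 := exp_mul_le_cosh_add_mul_sinh h2 l
            have h6 : Real.exp (-(l ^ 2 / 2)) * Real.cosh l ≤ 1 := by
              calc _ ≤ Real.exp (-(l ^ 2 / 2)) * Real.exp (l ^ 2 / 2) :=
                    mul_le_mul_of_nonneg_left (Real.cosh_le_exp_half_sq l) (Real.exp_pos _).le
                _ = 1 := by rw [← Real.exp_add]; simp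
            have h7 := mul_le_mul_of_nonneg_left h5 (Real.exp_pos (-(l ^ 2 / 2))).le
            simp only [κ]
            linarith
        change W (m + 1) ω ≤ W m ω + κ * (W m ω * Y m ω)
        rw [h3]
        have := mul_le_mul_of_nonneg_left h4 (Real.exp_pos
          (∑ i ∈ Finset.range m, (l * Y i ω - l ^ 2 / 2 * v i ω))).le
        change W m ω * _ ≤ W m ω * _ at this
        linarith
      rw [integral_add (hWi _ hm'.le) (hWYi.const_mul κ), integral_const_mul,
        horth m hm' (W m) (hWG m hm') ⟨_, hWb m hm'.le⟩] at hle
      simpa using hle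
  have hsub : {ω | t ≤ ∑ j ∈ Finset.range K, Y j ω} ⊆
      {ω | Real.exp (t ^ 2 / (2 * n)) ≤ W K ω} := by
    intro ω hω
    simp only [Set.mem_ofPred_eq] at hω ⊢
    refine Real.exp_le_exp.2 ?_
    rw [Finset.sum_sub_distrib, ← Finset.mul_sum, ← Finset.mul_sum]
    have h1 := mul_le_mul_of_nonneg_left hω hl0
    have h2 := mul_le_mul_of_nonneg_left (hvn ω) (by positivity : 0 ≤ l ^ 2 / 2)
    have h3 : t ^ 2 / (2 * n) = l * t - l ^ 2 / 2 * n := by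
      rw [hl]; field_simp; ring
    linarith
  have hmarkov := mul_meas_ge_le_integral_of_nonneg
    (Filter.Eventually.of_forall fun ω => (Real.exp_pos _).le) (hWi K le_rfl)
    (Real.exp (t ^ 2 / (2 * n)))
  have h1 := hmarkov.trans (hstep K le_rfl)
  have h2 := measureReal_mono (μ := μ) hsub
  rw [Real.exp_neg, ← one_div, le_div_iff₀ (Real.exp_pos _), mul_comm]
  exact (mul_le_mul_of_nonneg_left h2 (Real.exp_pos _).le).trans h1

end Azuma

/-! ### Measurability with respect to the histories -/

section Measurability

lemma measurable_eval_of_fintype {Ω T : Type*} {m : MeasurableSpace Ω} [Fintype T]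
    [MeasurableSpace T] [DiscreteMeasurableSpace T] {f : Ω → T} (hf : Measurable f)
    {F : T → Ω → ℝ} (hF : ∀ t, Measurable (F t)) : Measurable fun ω => F (f ω) ω := by
  classical
  have h : (fun ω => F (f ω) ω) = fun ω => ∑ t, if f ω = t then F t ω else 0 := by
    funext ω; simp
  rw [h]
  exact Finset.measurable_sum _ fun t _ =>
    Measurable.ite (hf (measurableSet_singleton t)) (hF t) measurable_const

namespace Interaction

variable {S A : Type*} {H : ℕ} {Ω : Type*} [MeasurableSpace S] [MeasurableSpace A]
  (X : Interaction S A H Ω)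

lemma measurable_priv_preAction {j k : ℕ} (hjk : j ≤ k) (h : Fin H) :
    Measurable[X.preAction k h] (X.privN j) ∧ Measurable[X.preAction k h] (X.privC j) ∧
      Measurable[X.preAction k h] (X.privNS j) := by
  have key : MeasurableSpace.comap (X.privN j) inferInstance
      ⊔ MeasurableSpace.comap (X.privC j) inferInstance
      ⊔ MeasurableSpace.comap (X.privNS j) inferInstance ≤ X.preAction k h :=
    le_sup_of_le_left (le_sup_of_le_left (le_sup_of_le_left
      (le_iSup₂_of_le (f := fun j (_ : j ∈ Set.Iic k) =>
        MeasurableSpace.comap (X.privN j) inferInstance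
      ⊔ MeasurableSpace.comap (X.privC j) inferInstance
      ⊔ MeasurableSpace.comap (X.privNS j) inferInstance) j hjk le_rfl)))
  exact ⟨measurable_iff_comap_le.2 ((le_sup_left.trans le_sup_left).trans key),
    measurable_iff_comap_le.2 ((le_sup_right.trans le_sup_left).trans key),
    measurable_iff_comap_le.2 (le_sup_right.trans key)⟩

lemma measurable_state_preAction_of_lt {j k : ℕ} (hjk : j < k) (h : Fin H) (i : Fin (H + 1)) :
    Measurable[X.preAction k h] (X.state j i) := by
  refine measurable_iff_comap_le.2 (le_sup_of_le_left (le_sup_of_le_left (le_sup_of_le_right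
    (le_iSup₂_of_le (f := fun j (_ : j ∈ Set.Iio k) =>
      ((⨆ i, MeasurableSpace.comap (X.state j i) inferInstance)
      ⊔ ⨆ i, (MeasurableSpace.comap (X.action j i) inferInstance
        ⊔ MeasurableSpace.comap (X.cost j i) inferInstance))) j hjk ?_))))
  exact le_sup_of_le_left (le_iSup (fun i => MeasurableSpace.comap (X.state j i) inferInstance) i)

lemma measurable_action_cost_preAction_of_lt {j k : ℕ} (hjk : j < k) (h i : Fin H) :
    Measurable[X.preAction k h] (X.action j i) ∧ Measurable[X.preAction k h] (X.cost j i) := by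
  have key : MeasurableSpace.comap (X.action j i) inferInstance
        ⊔ MeasurableSpace.comap (X.cost j i) inferInstance ≤ X.preAction k h := by
    refine le_sup_of_le_left (le_sup_of_le_left (le_sup_of_le_right
      (le_iSup₂_of_le (f := fun j (_ : j ∈ Set.Iio k) =>
        ((⨆ i, MeasurableSpace.comap (X.state j i) inferInstance)
        ⊔ ⨆ i, (MeasurableSpace.comap (X.action j i) inferInstance
          ⊔ MeasurableSpace.comap (X.cost j i) inferInstance))) j hjk ?_)))
    exact le_sup_of_le_right (le_iSup (fun i => MeasurableSpace.comap (X.action j i) inferInstance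
          ⊔ MeasurableSpace.comap (X.cost j i) inferInstance) i)
  exact ⟨measurable_iff_comap_le.2 (le_sup_left.trans key),
    measurable_iff_comap_le.2 (le_sup_right.trans key)⟩

lemma measurable_state_preAction (k : ℕ) (h : Fin H) :
    Measurable[X.preAction k h] (X.state k h.castSucc) :=
  measurable_iff_comap_le.2 (le_sup_of_le_left (le_sup_of_le_right
    (le_iSup₂_of_le (f := fun i (_ : i ∈ Set.Iic h.castSucc) =>
      MeasurableSpace.comap (X.state k i) inferInstance) h.castSucc (Set.mem_Iic.2 le_rfl) le_rfl)))

lemma preAction_mono (k : ℕ) {h h' : Fin H} (hh : h ≤ h') : X.preAction k h ≤ X.preAction k h' :=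
  sup_le_sup (sup_le_sup le_rfl
    (biSup_mono fun _ hi => Set.mem_Iic.2 ((Set.mem_Iic.1 hi).trans
      (Fin.castSucc_le_castSucc_iff.2 hh))))
    (biSup_mono fun _ hi => Set.mem_Iio.2 ((Set.mem_Iio.1 hi).trans_le hh))

lemma preAction_le_postAction (k : ℕ) (h : Fin H) : X.preAction k h ≤ X.postAction k h :=
  le_sup_left

lemma measurable_action_postAction (k : ℕ) (h : Fin H) :
    Measurable[X.postAction k h] (X.action k h) :=
  measurable_iff_comap_le.2 le_sup_right

lemma measurable_state_postAction (k : ℕ) (h : Fin H) :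
    Measurable[X.postAction k h] (X.state k h.castSucc) :=
  (X.measurable_state_preAction k h).mono (X.preAction_le_postAction k h) le_rfl

end Interaction

namespace IsRun

variable {S A : Type*} [Fintype S] [Fintype A] {H : ℕ} {Ω : Type*} [MeasurableSpace S]
  [MeasurableSpace A] {m0 : MeasurableSpace Ω} {M : MDP S A H} {s₁ : S} {p : Params}
  {μ : Measure Ω} {X : Interaction S A H Ω}

lemma preAction_le (hX : IsRun M s₁ p μ X) {k : ℕ} (hk : k < p.K) (h : Fin H) :
    X.preAction k h ≤ m0 := by
  refine sup_le (sup_le (sup_le ?_ ?_) ?_) ?_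
  · refine iSup₂_le fun j hj => ?_
    have hj' : j < p.K := (Set.mem_Iic.1 hj).trans_lt hk
    exact sup_le (sup_le (hX.measurable_privN j hj').comap_le (hX.measurable_privC j hj').comap_le)
      (hX.measurable_privNS j hj').comap_le
  · refine iSup₂_le fun j hj => ?_
    have hj' : j < p.K := (Set.mem_Iio.1 hj).trans hk
    exact sup_le (iSup_le fun i => (hX.measurable_state j hj' i).comap_le)
      (iSup_le fun i => sup_le (hX.measurable_action j hj' i).comap_le
        (hX.measurable_cost j hj' i).comap_le)
  · exact iSup₂_le fun i _ => (hX.measurable_state k hk i).comap_le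
  · exact iSup₂_le fun i _ => sup_le (hX.measurable_action k hk i).comap_le
        (hX.measurable_cost k hk i).comap_le

lemma postAction_le (hX : IsRun M s₁ p μ X) {k : ℕ} (hk : k < p.K) (h : Fin H) :
    X.postAction k h ≤ m0 :=
  sup_le (hX.preAction_le hk h) (hX.measurable_action k hk h).comap_le

end IsRun

variable {S A : Type*} [Fintype S] [Fintype A] {H : ℕ} {Ω : Type*} {m : MeasurableSpace Ω}

/-- Measurability of random counts. -/
def MeasurableCounts (m : MeasurableSpace Ω) (n : Ω → Counts S A H) : Prop :=
  Measurable[m] (fun ω => (n ω).N) ∧ Measurable[m] (fun ω => (n ω).C) ∧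
    Measurable[m] (fun ω => (n ω).NS)

omit [Fintype S] [Fintype A] in
lemma Interaction.measurableCounts_preAction [MeasurableSpace S] [MeasurableSpace A]
    (X : Interaction S A H Ω) {j k : ℕ} (hjk : j ≤ k) (h : Fin H) :
    MeasurableCounts (X.preAction k h) fun ω => X.counts ω j :=
  X.measurable_priv_preAction hjk h

omit [Fintype S] [Fintype A] in
lemma MeasurableCounts.den {n : Ω → Counts S A H} (hn : MeasurableCounts m n) (p : Params)
    (h : Fin H) (s : S) (a : A) : Measurable fun ω => den p (n ω) h s a := by
  have hN : Measurable fun ω => (n ω).N h s a :=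
    measurable_pi_iff.1 (measurable_pi_iff.1 (measurable_pi_iff.1 hn.1 h) s) a
  exact measurable_const.max (hN.add_const _)

lemma MeasurableCounts.bonus {n : Ω → Counts S A H} (hn : MeasurableCounts m n) (p : Params)
    (h : Fin H) (s : S) (a : A) : Measurable fun ω => bonus p (n ω) h s a := by
  have hD := hn.den p h s a
  unfold PrivateRL.bonus bonusC bonusP
  fun_prop

lemma MeasurableCounts.qStep {n : Ω → Counts S A H} (hn : MeasurableCounts m n) (p : Params)
    {V : Ω → S → ℝ} (hV : ∀ s, Measurable fun ω => V ω s) (h : Fin H) (s : S) (a : A) :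
    Measurable fun ω => qStep p (n ω) h (V ω) s a := by
  have hD := hn.den p h s a
  have hβ := hn.bonus p h s a
  have hC : Measurable fun ω => (n ω).C h s a :=
    measurable_pi_iff.1 (measurable_pi_iff.1 (measurable_pi_iff.1 hn.2.1 h) s) a
  have hNS : ∀ s', Measurable fun ω => (n ω).NS h s a s' := fun s' => measurable_pi_iff.1
    (measurable_pi_iff.1 (measurable_pi_iff.1 (measurable_pi_iff.1 hn.2.2 h) s) a) s'
  exact measurable_const.min (measurable_const.max (Measurable.sub (Measurable.add
    (hC.div hD) (Finset.measurable_sum _ fun s' _ => (hV s').mul ((hNS s').div hD))) hβ))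

lemma MeasurableCounts.vEst {n : Ω → Counts S A H} (hn : MeasurableCounts m n) (p : Params)
    {π : Ω → Fin H → S → A → ℝ} (hπ : ∀ h s a, Measurable fun ω => π ω h s a)
    (i : Fin (H + 1)) (s : S) : Measurable fun ω => vEst p (n ω) (π ω) i s := by
  induction i using Fin.reverseInduction generalizing s with
  | last => simp only [vEst_last]; exact measurable_const
  | cast h ih =>
    simp only [vEst_castSucc]
    exact Finset.measurable_sum _ fun a _ => (hn.qStep p ih h s a).mul (hπ h s a)

lemma MeasurableCounts.qEst {n : Ω → Counts S A H} (hn : MeasurableCounts m n) (p : Params)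
    {π : Ω → Fin H → S → A → ℝ} (hπ : ∀ h s a, Measurable fun ω => π ω h s a)
    (h : Fin H) (s : S) (a : A) : Measurable fun ω => qEst p (n ω) (π ω) h s a :=
  hn.qStep p (hn.vEst p hπ h.succ) h s a

/-- The update at the end of episode j uses the counts of episode j, so the policy of episode k
involves only the indices j < k. -/
lemma measurable_policy (p : Params) {n : Ω → ℕ → Counts S A H} {k : ℕ}
    (hn : ∀ j < k, MeasurableCounts m fun ω => n ω j) (h : Fin H) (s : S) (a : A) :
    Measurable fun ω => policy p (n ω) k h s a := by
  induction k generalizing h s a with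
  | zero => exact measurable_const
  | succ k ih =>
    have hk := ih fun j hj => hn j (hj.trans k.lt_succ_self)
    have hq := (hn k k.lt_succ_self).qEst p hk
    have hw : ∀ b, Measurable fun ω => policy p (n ω) k h s b *
        Real.exp (-p.η * qEst p (n ω k) (policy p (n ω) k) h s b) := fun b =>
      (hk h s b).mul (Real.measurable_exp.comp ((hq h s b).const_mul _))
    exact (hw a).div (Finset.measurable_sum _ fun b _ => hw b)

end Measurability

/-! ### Integration against conditional laws -/

section ConditionalLaw

variable {Ω : Type*} {m m0 : MeasurableSpace Ω} {μ : Measure Ω} [IsProbabilityMeasure μ]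

/-- The weak form in which all conditional laws of the run are used: testing against bounded
functions of the past. -/
lemma integral_mul_eq_of_condExp (hm : m ≤ m0) {f q Z : Ω → ℝ} (hf : Integrable f μ)
    (hq : μ[f | m] =ᵐ[μ] q) (hZ : Measurable[m] Z) (hZb : ∃ b, ∀ᵐ ω ∂μ, |Z ω| ≤ b) :
    Integrable (fun ω => Z ω * f ω) μ ∧ Integrable (fun ω => Z ω * q ω) μ ∧
      ∫ ω, Z ω * f ω ∂μ = ∫ ω, Z ω * q ω ∂μ := by
  obtain ⟨b, hb⟩ := hZb
  have hZs : AEStronglyMeasurable Z μ := (hZ.mono hm le_rfl).aestronglyMeasurable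
  have h1 : Integrable (fun ω => Z ω * f ω) μ := hf.bdd_mul hZs hb
  have h2 : Integrable (fun ω => Z ω * q ω) μ :=
    (integrable_condExp.congr hq).bdd_mul hZs hb
  refine ⟨h1, h2, ?_⟩
  rw [← integral_condExp hm]
  refine integral_congr_ae ?_
  filter_upwards [condExp_mul_of_stronglyMeasurable_left hZ.stronglyMeasurable h1 hf, hq]
    with ω h3 h4
  rw [← h4]
  exact h3

/-- Integrating out a finite-valued variable with a given conditional law. -/
lemma integral_eval_eq_of_condLaw {T : Type*} [Fintype T] [MeasurableSpace T]
    [DiscreteMeasurableSpace T] (hm : m ≤ m0) {f : Ω → T} (hf : Measurable f) {q : T → Ω → ℝ}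
    (hq : ∀ t, μ[({ω | f ω = t}.indicator fun _ => (1 : ℝ)) | m] =ᵐ[μ] q t) {F : T → Ω → ℝ}
    (hF : ∀ t, Measurable[m] (F t)) (hFb : ∀ t, ∃ b, ∀ᵐ ω ∂μ, |F t ω| ≤ b) :
    ∫ ω, F (f ω) ω ∂μ = ∫ ω, ∑ t, q t ω * F t ω ∂μ := by
  classical
  have h1 : ∀ t, Integrable ({ω | f ω = t}.indicator fun _ => (1 : ℝ)) μ := fun t =>
    (integrable_const _).indicator (hf (measurableSet_singleton t))
  have h2 := fun t => integral_mul_eq_of_condExp hm (h1 t) (hq t) (hF t) (hFb t)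
  have h3 : (fun ω => F (f ω) ω) =
      fun ω => ∑ t, F t ω * ({ω | f ω = t}.indicator fun _ => (1 : ℝ)) ω := by
    funext ω
    simp [Set.indicator_apply]
  rw [h3, integral_finsetSum _ fun t _ => (h2 t).1]
  simp only [mul_comm (q _ _)]
  rw [integral_finsetSum _ fun t _ => (h2 t).2.1]
  exact Finset.sum_congr rfl fun t _ => (h2 t).2.2

end ConditionalLaw

/-! ### Concentration of the empirical counts -/

/-! ### Freezing a process after a given number of visits -/

section Freezing

variable (b : ℕ → Prop) [DecidablePred b]

lemma sum_freeze_eq_min (n K : ℕ) :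
    ∑ j ∈ Finset.range K, (if b j ∧ Nat.count b j < n then 1 else 0) = min (Nat.count b K) n := by
  induction K with
  | zero => simp
  | succ K ih =>
    rw [Finset.sum_range_succ, ih, Nat.count_succ]
    by_cases hb : b K
    · by_cases hc : Nat.count b K < n <;> simp [hb, hc] <;> omega
    · simp [hb]

/-- A sum up to an arbitrary time k, which may depend on the sample, becomes a frozen sum over the
fixed range K that depends on k only through the number n of visits. -/
lemma sum_freeze_mul_eq {n k K : ℕ} (hkK : k ≤ K) (hk : Nat.count b k = n) (ξ : ℕ → ℝ) :
    ∑ j ∈ Finset.range K, (if b j ∧ Nat.count b j < n then 1 else 0) * ξ j =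
      ∑ j ∈ Finset.range k, if b j then ξ j else 0 := by
  rw [← Finset.sum_range_add_sum_Ico _ hkK]
  have h1 : ∑ j ∈ Finset.Ico k K, (if b j ∧ Nat.count b j < n then 1 else 0) * ξ j = 0 := by
    refine Finset.sum_eq_zero fun j hj => ?_
    have := Nat.count_monotone b (Finset.mem_Ico.1 hj).1
    rw [if_neg (by omega), zero_mul]
  rw [h1, add_zero]
  refine Finset.sum_congr rfl fun j hj => ?_
  by_cases hb : b j
  · have := Nat.count_strict_mono hb (Finset.mem_range.1 hj)
    rw [if_pos ⟨hb, by omega⟩, if_pos hb, one_mul]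
  · simp [hb]

end Freezing

section Concentration

variable {S A : Type*} {H : ℕ} {Ω : Type*} [DecidableEq S] [DecidableEq A]

namespace Interaction

lemma trueN_eq_count (X : Interaction S A H Ω) (k : ℕ) (ω : Ω) (h : Fin H) (s : S) (a : A) :
    X.trueN k ω h s a =
      Nat.count (fun j => X.state j h.castSucc ω = s ∧ X.action j h ω = a) k := by
  rw [trueN, Finset.sum_boole, Nat.count_eq_card_filter_range]

lemma trueN_eq_zero_or_one_le (X : Interaction S A H Ω) (k : ℕ) (ω : Ω) (h : Fin H) (s : S)
    (a : A) : X.trueN k ω h s a = 0 ∨ 1 ≤ X.trueN k ω h s a := by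
  rw [trueN_eq_count]
  rcases Nat.eq_zero_or_pos
    (Nat.count (fun j => X.state j h.castSucc ω = s ∧ X.action j h ω = a) k) with h0 | h0
  · left; exact_mod_cast h0
  · right; exact_mod_cast h0

/-- Indicator of a visit to `(s, a)` at step `h` of episode `j`, if fewer than `n` such visits
occurred before. -/
def freeze (X : Interaction S A H Ω) (h : Fin H) (s : S) (a : A) (n j : ℕ) (ω : Ω) : ℝ :=
  if (X.state j h.castSucc ω = s ∧ X.action j h ω = a) ∧
    Nat.count (fun j => X.state j h.castSucc ω = s ∧ X.action j h ω = a) j < n then 1 else 0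

lemma freeze_eq_zero_or_one (X : Interaction S A H Ω) (h : Fin H) (s : S) (a : A) (n j : ℕ)
    (ω : Ω) : X.freeze h s a n j ω = 0 ∨ X.freeze h s a n j ω = 1 := by
  unfold freeze
  split_ifs <;> simp

lemma measurable_freeze [MeasurableSpace S] [DiscreteMeasurableSpace S] [MeasurableSpace A]
    [DiscreteMeasurableSpace A] {m : MeasurableSpace Ω} (X : Interaction S A H Ω) (h : Fin H)
    (s : S) (a : A) (n j : ℕ) (hs : ∀ i ≤ j, Measurable (X.state i h.castSucc))
    (ha : ∀ i ≤ j, Measurable (X.action i h)) : Measurable (X.freeze h s a n j) := by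
  have hb : ∀ i ≤ j, MeasurableSet {ω | X.state i h.castSucc ω = s ∧ X.action i h ω = a} :=
    fun i hi => (hs i hi (measurableSet_singleton s)).inter (ha i hi (measurableSet_singleton a))
  have hc : Measurable fun ω =>
      Nat.count (fun j => X.state j h.castSucc ω = s ∧ X.action j h ω = a) j := by
    simp only [Nat.count_eq_card_filter_range, Finset.card_filter]
    exact Finset.measurable_sum _ fun i hi =>
      Measurable.ite (hb i (Finset.mem_range.1 hi).le) measurable_const measurable_const
  exact Measurable.ite ((hb j le_rfl).inter (hc measurableSet_Iio))
    measurable_const measurable_const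

lemma measurable_freeze_postAction [MeasurableSpace S] [DiscreteMeasurableSpace S]
    [MeasurableSpace A] [DiscreteMeasurableSpace A] (X : Interaction S A H Ω) (h : Fin H)
    (s : S) (a : A) (n : ℕ) {i j : ℕ} (hij : i ≤ j) :
    Measurable[X.postAction j h] (X.freeze h s a n i) := by
  refine X.measurable_freeze h s a n i (fun l hl => ?_) (fun l hl => ?_) <;>
    rcases (hl.trans hij).eq_or_lt with rfl | hlj
  · exact X.measurable_state_postAction l h
  · exact (X.measurable_state_preAction_of_lt hlj h _).mono (X.preAction_le_postAction j h) le_rfl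
  · exact X.measurable_action_postAction l h
  · exact (X.measurable_action_cost_preAction_of_lt hlj h h).1.mono
      (X.preAction_le_postAction j h) le_rfl

end Interaction

namespace IsRun

variable [Fintype S] [Fintype A] [MeasurableSpace S] [DiscreteMeasurableSpace S]
  [MeasurableSpace A] [DiscreteMeasurableSpace A] {m0 : MeasurableSpace Ω} {M : MDP S A H} {s₁ : S}
  {p : Params} {μ : Measure Ω} [IsProbabilityMeasure μ] {X : Interaction S A H Ω}

/-- Sums over the visits to `(s, a)` at step `h`, normalized by the number of visits. -/
lemma measure_exists_lt_sum_visits_le (hX : IsRun M s₁ p μ X) (h : Fin H) (s : S) (a : A)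
    {ξ : ℕ → Ω → ℝ} (hξ : ∀ j < p.K, Measurable (ξ j))
    (hξpast : ∀ k < p.K, ∀ j < k, Measurable[X.preAction k h] (ξ j))
    (hξb : ∀ j < p.K, ∀ᵐ ω ∂μ, |ξ j ω| ≤ 1)
    (horth : ∀ j < p.K, ∀ n, ∀ Z : Ω → ℝ, Measurable[X.postAction j h] Z →
      (∃ b, ∀ᵐ ω ∂μ, |Z ω| ≤ b) → ∫ ω, Z ω * (X.freeze h s a n j ω * ξ j ω) ∂μ = 0)
    {L : ℝ} (hL : 0 ≤ L) :
    μ.real {ω | ∃ k < p.K, L * Real.sqrt (X.trueN k ω h s a) <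
      ∑ j ∈ Finset.range k, if X.state j h.castSucc ω = s ∧ X.action j h ω = a then ξ j ω else 0}
      ≤ p.K * Real.exp (-(L ^ 2 / 2)) := by
  -- Union over the number n of visits instead of the episode: for fixed n the threshold is
  -- deterministic.
  have hsub : {ω | ∃ k < p.K, L * Real.sqrt (X.trueN k ω h s a) <
      ∑ j ∈ Finset.range k, if X.state j h.castSucc ω = s ∧ X.action j h ω = a then ξ j ω else 0}
      ⊆ ⋃ n ∈ Finset.Icc 1 p.K, {ω | L * Real.sqrt n ≤
        ∑ j ∈ Finset.range p.K, X.freeze h s a n j ω * ξ j ω} := by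
    rintro ω ⟨k, hk, hlt⟩
    rw [X.trueN_eq_count] at hlt
    have hle := Nat.count_le (p := fun j => X.state j h.castSucc ω = s ∧ X.action j h ω = a)
      (n := k)
    have hfr := sum_freeze_mul_eq (fun j => X.state j h.castSucc ω = s ∧ X.action j h ω = a)
      hk.le rfl fun j => ξ j ω
    -- Without visits both sides vanish, which contradicts the strict inequality.
    have hpos : 1 ≤ Nat.count (fun j => X.state j h.castSucc ω = s ∧ X.action j h ω = a) k := by
      by_contra h0
      rw [not_le, Nat.lt_one_iff] at h0
      rw [h0] at hfr
      rw [h0, ← hfr] at hlt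
      simp at hlt
    simp only [Set.mem_iUnion]
    refine ⟨_, Finset.mem_Icc.2 ⟨hpos, hle.trans hk.le⟩, ?_⟩
    refine hlt.le.trans (le_of_eq ?_)
    rw [← hfr]
    rfl
  refine (measureReal_mono hsub (measure_ne_top _ _)).trans ((measureReal_biUnion_finset_le _ _).trans ?_)
  have hn : ∀ n ∈ Finset.Icc 1 p.K, μ.real {ω | L * Real.sqrt n ≤
        ∑ j ∈ Finset.range p.K, X.freeze h s a n j ω * ξ j ω} ≤ Real.exp (-(L ^ 2 / 2)) := by
    intro n hn
    have hn0 : (0 : ℝ) < n := by exact_mod_cast (Finset.mem_Icc.1 hn).1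
    have hfr : ∀ j, ∀ i ≤ j, Measurable[X.postAction j h] (X.freeze h s a n i) := fun j i hij =>
      X.measurable_freeze_postAction h s a n hij
    have key := measure_sum_ge_le_of_orthogonal (μ := μ) (K := p.K)
      (G := fun j => X.postAction j h) (v := X.freeze h s a n)
      (Y := fun j ω => X.freeze h s a n j ω * ξ j ω)
      (fun j hj => hX.postAction_le hj h) (fun j _ => hfr j j le_rfl)
      (fun j ω => X.freeze_eq_zero_or_one h s a n j ω)
      (fun j _ i hij => hfr j i hij.le)
      (fun j hj i hij => (hfr j i hij.le).mul
        ((hξpast j hj i hij).mono (X.preAction_le_postAction j h) le_rfl))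
      (fun j hj => ((hfr j j le_rfl).mono (hX.postAction_le hj h) le_rfl).mul (hξ j hj))
      (fun j hj => by
        filter_upwards [hξb j hj] with ω hω
        rcases X.freeze_eq_zero_or_one h s a n j ω with h0 | h0 <;> simp [h0, hω])
      (fun j hj => horth j hj n) hn0 (by positivity : 0 ≤ L * Real.sqrt n)
      (fun ω => by
        have := sum_freeze_eq_min (fun j => X.state j h.castSucc ω = s ∧ X.action j h ω = a) n p.K
        have h1 : ∑ j ∈ Finset.range p.K, X.freeze h s a n j ω = ((min
            (Nat.count (fun j => X.state j h.castSucc ω = s ∧ X.action j h ω = a) p.K) n : ℕ)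
              : ℝ) := by
          rw [← this]; push_cast; rfl
        rw [h1]
        exact_mod_cast min_le_right _ _)
    refine key.trans (le_of_eq ?_)
    -- At the threshold L√n Azuma's exponent is L²/2 for every n.
    rw [mul_pow, Real.sq_sqrt hn0.le]
    congr 2
    field_simp
  refine (Finset.sum_le_sum hn).trans (le_of_eq ?_)
  simp

lemma measure_cost_deviation_le (hX : IsRun M s₁ p μ X) (h : Fin H) (s : S) (a : A) {L : ℝ}
    (hL : 0 ≤ L) :
    μ.real {ω | ∃ k < p.K, L * Real.sqrt (X.trueN k ω h s a) <
      |X.trueC k ω h s a - X.trueN k ω h s a * M.c h s a|} ≤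
      2 * (p.K * Real.exp (-(L ^ 2 / 2))) := by
  have main : ∀ e : ℝ, |e| = 1 → μ.real {ω | ∃ k < p.K, L * Real.sqrt (X.trueN k ω h s a) <
      ∑ j ∈ Finset.range k, if X.state j h.castSucc ω = s ∧ X.action j h ω = a then
        e * (X.cost j h ω - M.c h s a) else 0} ≤ p.K * Real.exp (-(L ^ 2 / 2)) := by
    intro e he
    refine hX.measure_exists_lt_sum_visits_le h s a
      (fun j hj => ((hX.measurable_cost j hj h).sub_const _).const_mul _)
      (fun k _ j hjk =>
        ((X.measurable_action_cost_preAction_of_lt hjk h h).2.sub_const _).const_mul _)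
      (fun j hj => ?_) (fun j hj n Z hZ hZb => ?_) hL
    · filter_upwards [hX.cost_mem j hj h] with ω hω
      rw [abs_mul, he, one_mul, abs_le]
      have h1 := M.c_nonneg h s a
      have h2 := M.c_le_one h s a
      exact ⟨by linarith [hω.1], by linarith [hω.2]⟩
    · have hfr := X.measurable_freeze_postAction h s a n (le_refl j)
      have hci : Integrable (X.cost j h) μ := by
        refine Integrable.of_bound (hX.measurable_cost j hj h).aestronglyMeasurable 1 ?_
        filter_upwards [hX.cost_mem j hj h] with ω hω
        rw [Real.norm_eq_abs, abs_of_nonneg hω.1]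
        exact hω.2
      have hZv : Measurable[X.postAction j h] fun ω => Z ω * X.freeze h s a n j ω := hZ.mul hfr
      have hZvb : ∃ b, ∀ᵐ ω ∂μ, |Z ω * X.freeze h s a n j ω| ≤ b := by
        obtain ⟨b, hb⟩ := hZb
        refine ⟨b, ?_⟩
        filter_upwards [hb] with ω hω
        rcases X.freeze_eq_zero_or_one h s a n j ω with h0 | h0
        · simpa [h0] using (abs_nonneg _).trans hω
        · simpa [h0] using hω
      obtain ⟨hi1, hi2, hi3⟩ := integral_mul_eq_of_condExp (hX.postAction_le hj h) hci
        (hX.cost_mean j hj h) hZv hZvb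
      -- Where the frozen indicator is nonzero, the visited pair is (s, a) and the conditional mean
      -- is a constant.
      have hpt : ∀ ω, Z ω * X.freeze h s a n j ω *
          M.c h (X.state j h.castSucc ω) (X.action j h ω) =
          Z ω * X.freeze h s a n j ω * M.c h s a := by
        intro ω
        unfold Interaction.freeze
        split_ifs with hv
        · rw [hv.1.1, hv.1.2]
        · simp
      simp only [hpt] at hi2 hi3
      calc _ = ∫ ω, e * (Z ω * X.freeze h s a n j ω * X.cost j h ω -
            Z ω * X.freeze h s a n j ω * M.c h s a) ∂μ := by
            congr 1; funext ω; ring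
        _ = 0 := by
            rw [integral_const_mul, integral_sub hi1 hi2, hi3, sub_self, mul_zero]
  have hsub : {ω | ∃ k < p.K, L * Real.sqrt (X.trueN k ω h s a) <
      |X.trueC k ω h s a - X.trueN k ω h s a * M.c h s a|} ⊆
      {ω | ∃ k < p.K, L * Real.sqrt (X.trueN k ω h s a) <
      ∑ j ∈ Finset.range k, if X.state j h.castSucc ω = s ∧ X.action j h ω = a then
        1 * (X.cost j h ω - M.c h s a) else 0} ∪
      {ω | ∃ k < p.K, L * Real.sqrt (X.trueN k ω h s a) <
      ∑ j ∈ Finset.range k, if X.state j h.castSucc ω = s ∧ X.action j h ω = a then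
        (-1) * (X.cost j h ω - M.c h s a) else 0} := by
    rintro ω ⟨k, hk, hlt⟩
    have heq : ∀ e : ℝ, (∑ j ∈ Finset.range k,
        if X.state j h.castSucc ω = s ∧ X.action j h ω = a then
          e * (X.cost j h ω - M.c h s a) else 0) =
        e * (X.trueC k ω h s a - X.trueN k ω h s a * M.c h s a) := by
      intro e
      rw [Interaction.trueC, Interaction.trueN, Finset.sum_mul, ← Finset.sum_sub_distrib,
        Finset.mul_sum]
      refine Finset.sum_congr rfl fun j _ => ?_
      split_ifs <;> ring
    rcases lt_abs.1 hlt with h1 | h1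
    · exact Or.inl ⟨k, hk, by rw [heq]; linarith⟩
    · exact Or.inr ⟨k, hk, by rw [heq]; linarith⟩
  have h1 := main 1 (by simp)
  have h2 := main (-1) (by simp)
  have h3 := (measureReal_mono (μ := μ) hsub).trans (measureReal_union_le _ _)
  linarith

/-- For a fixed set B, the indicator of landing in B minus P(B) is a martingale difference bounded
by 1 at the visits. The factor 2^S is the union bound over B. -/
lemma measure_transition_deviation_le (hX : IsRun M s₁ p μ X) (h : Fin H) (s : S) (a : A) {L : ℝ}
    (hL : 0 ≤ L) :
    μ.real {ω | ∃ k < p.K, ∃ B : Finset S, L * Real.sqrt (X.trueN k ω h s a) <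
      ∑ s' ∈ B, (X.trueNS k ω h s a s' - X.trueN k ω h s a * M.P h s a s')} ≤
      2 ^ Fintype.card S * (p.K * Real.exp (-(L ^ 2 / 2))) := by
  have main : ∀ B : Finset S, μ.real {ω | ∃ k < p.K, L * Real.sqrt (X.trueN k ω h s a) <
      ∑ j ∈ Finset.range k, if X.state j h.castSucc ω = s ∧ X.action j h ω = a then
        ((if X.state j h.succ ω ∈ B then 1 else 0) - ∑ s' ∈ B, M.P h s a s') else 0} ≤
        p.K * Real.exp (-(L ^ 2 / 2)) := by
    intro B
    have hB0 : 0 ≤ ∑ s' ∈ B, M.P h s a s' := Finset.sum_nonneg fun _ _ => M.P_nonneg _ _ _ _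
    have hB1 : ∑ s' ∈ B, M.P h s a s' ≤ 1 := by
      rw [← M.P_sum h s a]
      exact Finset.sum_le_sum_of_subset_of_nonneg (Finset.subset_univ _)
        fun _ _ _ => M.P_nonneg _ _ _ _
    have hb : ∀ x : S, |(if x ∈ B then (1 : ℝ) else 0) - ∑ s' ∈ B, M.P h s a s'| ≤ 1 := by
      intro x
      rw [abs_le]
      split_ifs <;> constructor <;> linarith
    have hm : Measurable fun x : S =>
        (if x ∈ B then (1 : ℝ) else 0) - ∑ s' ∈ B, M.P h s a s' := Measurable.of_discrete
    refine hX.measure_exists_lt_sum_visits_le h s a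
      (ξ := fun j ω => (if X.state j h.succ ω ∈ B then 1 else 0) - ∑ s' ∈ B, M.P h s a s')
      (fun j hj => hm.comp (hX.measurable_state j hj _))
      (fun k _ j hjk => hm.comp (X.measurable_state_preAction_of_lt hjk h _))
      (fun j hj => Filter.Eventually.of_forall fun ω => hb _) (fun j hj n Z hZ hZb => ?_) hL
    have hfr := X.measurable_freeze_postAction h s a n (le_refl j)
    have key := integral_eval_eq_of_condLaw (hX.postAction_le hj h)
      (hX.measurable_state j hj h.succ) (hX.state_law j hj h)
      (F := fun s' ω => Z ω * (X.freeze h s a n j ω *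
        ((if s' ∈ B then 1 else 0) - ∑ s' ∈ B, M.P h s a s')))
      (fun s' => hZ.mul (hfr.mul_const _)) (fun s' => by
        obtain ⟨b, hb'⟩ := hZb
        refine ⟨b, ?_⟩
        filter_upwards [hb'] with ω hω
        rw [abs_mul]
        refine (mul_le_of_le_one_right (abs_nonneg _) ?_).trans hω
        rcases X.freeze_eq_zero_or_one h s a n j ω with h0 | h0
        · simp [h0]
        · simpa [h0] using hb s')
    rw [key]
    refine integral_eq_zero_of_ae (Filter.Eventually.of_forall fun ω => ?_)
    by_cases hv : (X.state j h.castSucc ω = s ∧ X.action j h ω = a) ∧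
      Nat.count (fun j => X.state j h.castSucc ω = s ∧ X.action j h ω = a) j < n
    · have : ∑ s', M.P h s a s' * ((if s' ∈ B then 1 else 0) - ∑ s' ∈ B, M.P h s a s') = 0 := by
        simp only [mul_sub, Finset.sum_sub_distrib, mul_ite, mul_one, mul_zero]
        rw [← Finset.sum_mul, M.P_sum, one_mul]
        simp
      simp only [hv.1.1, hv.1.2, Pi.zero_apply]
      refine Eq.trans ?_
        ((congrArg (fun x => Z ω * X.freeze h s a n j ω * x) this).trans (mul_zero _))
      rw [Finset.mul_sum]
      exact Finset.sum_congr rfl fun s' _ => by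
        ring
    · simp [Interaction.freeze, hv]
  have hsub : {ω | ∃ k < p.K, ∃ B : Finset S, L * Real.sqrt (X.trueN k ω h s a) <
      ∑ s' ∈ B, (X.trueNS k ω h s a s' - X.trueN k ω h s a * M.P h s a s')} ⊆
      ⋃ B ∈ (Finset.univ : Finset (Finset S)),
        {ω | ∃ k < p.K, L * Real.sqrt (X.trueN k ω h s a) <
      ∑ j ∈ Finset.range k, if X.state j h.castSucc ω = s ∧ X.action j h ω = a then
        ((if X.state j h.succ ω ∈ B then 1 else 0) - ∑ s' ∈ B, M.P h s a s') else 0} := by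
    rintro ω ⟨k, hk, B, hlt⟩
    simp only [Set.mem_iUnion]
    refine ⟨B, Finset.mem_univ _, k, hk, hlt.trans_le (le_of_eq ?_)⟩
    rw [Finset.sum_sub_distrib, ← Finset.mul_sum]
    simp only [Interaction.trueNS, Interaction.trueN]
    rw [Finset.sum_comm, Finset.sum_mul, ← Finset.sum_sub_distrib]
    refine Finset.sum_congr rfl fun j _ => ?_
    by_cases hv : X.state j h.castSucc ω = s ∧ X.action j h ω = a
    · simp [hv]
    · rw [if_neg hv, if_neg hv, zero_mul, sub_zero]
      exact Finset.sum_eq_zero fun s' _ => if_neg fun h' => hv ⟨h'.1, h'.2.1⟩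
  refine (measureReal_mono hsub (measure_ne_top _ _)).trans ((measureReal_biUnion_finset_le _ _).trans ?_)
  refine (Finset.sum_le_sum fun B _ => main B).trans (le_of_eq ?_)
  simp

end IsRun

end Concentration

/-! ### Expected versus realized totals over the episodes -/

section RemainingTotal

variable {S A : Type*} [Fintype S] [Fintype A] {H : ℕ}

/-- Expected total of `g` from a given step on. -/
def remainingTotal (P : Fin H → S → A → S → ℝ) (π g : Fin H → S → A → ℝ) :
    Fin (H + 1) → S → ℝ :=
  Fin.reverseInduction (motive := fun _ => S → ℝ) (fun _ => 0)
    (fun h V s => ∑ a, π h s a * (g h s a + ∑ s', P h s a s' * V s'))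

variable {P : Fin H → S → A → S → ℝ} {π g : Fin H → S → A → ℝ}

lemma remainingTotal_last (s : S) : remainingTotal P π g (Fin.last H) s = 0 := by
  simp [remainingTotal]

lemma remainingTotal_castSucc (h : Fin H) (s : S) : remainingTotal P π g h.castSucc s =
    ∑ a, π h s a * (g h s a + ∑ s', P h s a s' * remainingTotal P π g h.succ s') := by
  simp [remainingTotal]

/-- By telescoping: the Bellman differences of the remaining totals have the same average over the
actions as `g`. -/
lemma remainingTotal_zero (hπ : ∀ h s, ∑ a, π h s a = 1) (s : S) :
    remainingTotal P π g 0 s = expectedTotal P π g s := by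
  rw [← expectedTotal_telescope (P := P) hπ (remainingTotal P π g) remainingTotal_last s]
  refine expectedTotal_congr (fun h s => ?_) s
  simp only [mul_sub, Finset.sum_sub_distrib]
  rw [← Finset.sum_mul, hπ, one_mul, remainingTotal_castSucc]
  simp only [mul_add, Finset.sum_add_distrib]
  ring

lemma remainingTotal_mem (hP : ∀ h s a s', 0 ≤ P h s a s') (hP1 : ∀ h s a, ∑ s', P h s a s' = 1)
    (hπ : IsPolicy π) {b : ℝ} (hg : ∀ h s a, 0 ≤ g h s a) (hgb : ∀ h s a, g h s a ≤ b)
    (i : Fin (H + 1)) (s : S) :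
    0 ≤ remainingTotal P π g i s ∧ remainingTotal P π g i s ≤ ((H : ℝ) - (i : ℕ)) * b := by
  induction i using Fin.reverseInduction generalizing s with
  | last => simp [remainingTotal_last]
  | cast h ih =>
    rw [remainingTotal_castSucc]
    constructor
    · exact Finset.sum_nonneg fun a _ => mul_nonneg (hπ.1 _ _ _) (add_nonneg (hg _ _ _)
        (Finset.sum_nonneg fun s' _ => mul_nonneg (hP _ _ _ _) (ih s').1))
    · calc _ ≤ ∑ a, π h s a * (b + ∑ s', P h s a s' * (((H : ℝ) - (h.succ : ℕ)) * b)) :=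
            Finset.sum_le_sum fun a _ => mul_le_mul_of_nonneg_left (add_le_add (hgb _ _ _)
              (Finset.sum_le_sum fun s' _ => mul_le_mul_of_nonneg_left (ih s').2 (hP _ _ _ _)))
              (hπ.1 _ _ _)
        _ = _ := by
          simp only [← Finset.sum_mul, hP1, hπ.2]
          simp
          ring

lemma measurable_remainingTotal {Ω : Type*} {m : MeasurableSpace Ω}
    {π g : Ω → Fin H → S → A → ℝ} (hπ : ∀ h s a, Measurable fun ω => π ω h s a)
    (hg : ∀ h s a, Measurable fun ω => g ω h s a) (i : Fin (H + 1)) (s : S) :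
    Measurable fun ω => remainingTotal P (π ω) (g ω) i s := by
  induction i using Fin.reverseInduction generalizing s with
  | last => simp only [remainingTotal_last]; exact measurable_const
  | cast h ih =>
    simp only [remainingTotal_castSucc]
    exact Finset.measurable_sum _ fun a _ => (hπ h s a).mul ((hg h s a).add
      (Finset.measurable_sum _ fun s' _ => (ih s').const_mul _))

end RemainingTotal

namespace IsRun

variable {S A : Type*} [Fintype S] [Fintype A] [Nonempty A] {H : ℕ} {Ω : Type*}
  [MeasurableSpace S] [DiscreteMeasurableSpace S]
  [MeasurableSpace A] [DiscreteMeasurableSpace A] {m0 : MeasurableSpace Ω} {M : MDP S A H} {s₁ : S}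
  {p : Params} {μ : Measure Ω} [IsProbabilityMeasure μ] {X : Interaction S A H Ω}

omit [Nonempty A] [DiscreteMeasurableSpace S] [DiscreteMeasurableSpace A]
  [IsProbabilityMeasure μ] in
lemma measurable_policy_preAction {j k : ℕ} (hjk : j ≤ k) (h h' : Fin H) (s : S) (a : A) :
    Measurable[X.preAction k h] fun ω => policy p (X.counts ω) j h' s a :=
  measurable_policy p (n := X.counts)
    (fun _ hi => X.measurableCounts_preAction (hi.le.trans hjk) h) h' s a

/-- One step of an episode, tested against the past. -/
lemma integral_mul_realized (hX : IsRun M s₁ p μ X) {k : ℕ} (hk : k < p.K) (h : Fin H)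
    {g : Ω → Fin H → S → A → ℝ} {b : ℝ} (hb : 0 ≤ b)
    (hg : ∀ h' s a, Measurable[X.preAction k h] fun ω => g ω h' s a)
    (hg0 : ∀ ω h s a, 0 ≤ g ω h s a) (hgb : ∀ ω h s a, g ω h s a ≤ b)
    {Z : Ω → ℝ} (hZ : Measurable[X.preAction k h] Z) (hZb : ∃ b, ∀ᵐ ω ∂μ, |Z ω| ≤ b) :
    ∫ ω, Z ω * g ω h (X.state k h.castSucc ω) (X.action k h ω) ∂μ =
      ∫ ω, Z ω * remainingTotal M.P (policy p (X.counts ω) k) (g ω) h.castSucc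
        (X.state k h.castSucc ω) ∂μ -
      ∫ ω, Z ω * remainingTotal M.P (policy p (X.counts ω) k) (g ω) h.succ
        (X.state k h.succ ω) ∂μ := by
  obtain ⟨B, hB⟩ := hZb
  set U : Ω → Fin (H + 1) → S → ℝ := fun ω =>
    remainingTotal M.P (policy p (X.counts ω) k) (g ω) with hU
  have hUm : ∀ i s, Measurable[X.preAction k h] fun ω => U ω i s := fun i s =>
    measurable_remainingTotal (fun h' s a => measurable_policy_preAction le_rfl h h' s a) hg i s
  have hU0 : ∀ ω i s, 0 ≤ U ω i s ∧ U ω i s ≤ H * b := fun ω i s => by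
    obtain ⟨h1, h2⟩ := remainingTotal_mem M.P_nonneg M.P_sum (isPolicy_policy p (X.counts ω) k)
      (hg0 ω) (hgb ω) i s
    refine ⟨h1, h2.trans (mul_le_mul_of_nonneg_right ?_ hb)⟩
    have : (0 : ℝ) ≤ (i : ℕ) := Nat.cast_nonneg _
    linarith
  have hPU : ∀ ω s a, 0 ≤ ∑ s', M.P h s a s' * U ω h.succ s' ∧
      ∑ s', M.P h s a s' * U ω h.succ s' ≤ H * b := fun ω s a => by
    refine ⟨Finset.sum_nonneg fun s' _ => mul_nonneg (M.P_nonneg _ _ _ _) (hU0 ω _ s').1, ?_⟩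
    calc _ ≤ ∑ s', M.P h s a s' * (H * b) := Finset.sum_le_sum fun s' _ =>
          mul_le_mul_of_nonneg_left (hU0 ω _ s').2 (M.P_nonneg _ _ _ _)
      _ = H * b := by rw [← Finset.sum_mul, M.P_sum, one_mul]
  have hbd : ∀ {f : Ω → ℝ} {c : ℝ}, (∀ ω, 0 ≤ f ω ∧ f ω ≤ c) →
      ∀ᵐ ω ∂μ, |Z ω * f ω| ≤ B * c := by
    intro f c hf
    filter_upwards [hB] with ω hω
    rw [abs_mul, abs_of_nonneg (hf ω).1]
    exact mul_le_mul hω (hf ω).2 (hf ω).1 ((abs_nonneg _).trans hω)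
  have hst := X.measurable_state_preAction k h
  have hpm := hX.preAction_le hk h
  have hQm : ∀ a, Measurable[X.preAction k h] fun ω => Z ω *
      (g ω h (X.state k h.castSucc ω) a +
        ∑ s', M.P h (X.state k h.castSucc ω) a s' * U ω h.succ s') := fun a =>
    hZ.mul (measurable_eval_of_fintype hst
      (F := fun s ω => g ω h s a + ∑ s', M.P h s a s' * U ω h.succ s') fun s =>
        (hg h s a).add (Finset.measurable_sum _ fun s' _ => (hUm _ s').const_mul _))
  have hact := integral_eval_eq_of_condLaw hpm (hX.measurable_action k hk h)
    (hX.action_law k hk h) hQm (fun a => ⟨B * (b + H * b), hbd fun ω =>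
      ⟨add_nonneg (hg0 _ _ _ _) (hPU _ _ _).1, add_le_add (hgb _ _ _ _) (hPU _ _ _).2⟩⟩)
  have hle := X.preAction_le_postAction k h
  have hsta := integral_eval_eq_of_condLaw (hX.postAction_le hk h)
    (hX.measurable_state k hk h.succ) (hX.state_law k hk h)
    (F := fun s' ω => Z ω * U ω h.succ s')
    (fun s' => (hZ.mul (hUm _ s')).mono hle le_rfl)
    (fun s' => ⟨B * (H * b), hbd fun ω => hU0 ω _ s'⟩)
  -- The Bellman equation with the realized action in place of the average over actions; `hsta` then
  -- exchanges the average over next states for the realized one.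
  have hstate : ∫ ω, Z ω * U ω h.castSucc (X.state k h.castSucc ω) ∂μ =
      ∫ ω, (Z ω * g ω h (X.state k h.castSucc ω) (X.action k h ω) +
        Z ω * ∑ s', M.P h (X.state k h.castSucc ω) (X.action k h ω) s' * U ω h.succ s') ∂μ := by
    simp only [mul_add] at hact
    rw [hact]
    refine integral_congr_ae (Filter.Eventually.of_forall fun ω => ?_)
    simp only [hU]
    rw [remainingTotal_castSucc, Finset.mul_sum]
    exact Finset.sum_congr rfl fun a _ => by ring
  have hi1 : Integrable (fun ω => Z ω * g ω h (X.state k h.castSucc ω) (X.action k h ω)) μ := by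
    refine Integrable.of_bound ((hZ.mono hpm le_rfl).mul ?_).aestronglyMeasurable (B * b)
      (hbd fun ω => ⟨hg0 _ _ _ _, hgb _ _ _ _⟩)
    exact measurable_eval_of_fintype (hX.measurable_action k hk h)
      (F := fun a ω => g ω h (X.state k h.castSucc ω) a) fun a =>
        measurable_eval_of_fintype (hX.measurable_state k hk _) (F := fun s ω => g ω h s a)
          fun s => (hg h s a).mono hpm le_rfl
  have hi2 : Integrable (fun ω => Z ω * ∑ s', M.P h (X.state k h.castSucc ω) (X.action k h ω) s' *
      U ω h.succ s') μ := by
    refine Integrable.of_bound ((hZ.mono hpm le_rfl).mul ?_).aestronglyMeasurable (B * (H * b))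
      (hbd fun ω => hPU _ _ _)
    exact measurable_eval_of_fintype (hX.measurable_action k hk h)
      (F := fun a ω => ∑ s', M.P h (X.state k h.castSucc ω) a s' * U ω h.succ s') fun a =>
        measurable_eval_of_fintype (hX.measurable_state k hk _)
          (F := fun s ω => ∑ s', M.P h s a s' * U ω h.succ s')
          fun s => Finset.measurable_sum _ fun s' _ => ((hUm _ s').mono hpm le_rfl).const_mul _
  rw [hstate, integral_add hi1 hi2, hsta]
  have : (fun ω => Z ω * ∑ s', M.P h (X.state k h.castSucc ω) (X.action k h ω) s' *
      U ω h.succ s') = fun ω => ∑ t, M.P h (X.state k h.castSucc ω) (X.action k h ω) t *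
        (Z ω * U ω h.succ t) := by
    funext ω
    rw [Finset.mul_sum]
    exact Finset.sum_congr rfl fun s' _ => by ring
  rw [this]
  ring

/-- Each step contributes the difference of the remaining totals before and after it, so the sum
over steps telescopes to the total from the initial state. -/
lemma integral_mul_episode (hX : IsRun M s₁ p μ X) {k : ℕ} (hk : k < p.K) (hH : 0 < H)
    {g : Ω → Fin H → S → A → ℝ} {b : ℝ} (hb : 0 ≤ b)
    (hg : ∀ h' s a, Measurable[X.preAction k ⟨0, hH⟩] fun ω => g ω h' s a)
    (hg0 : ∀ ω h s a, 0 ≤ g ω h s a) (hgb : ∀ ω h s a, g ω h s a ≤ b)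
    {Z : Ω → ℝ} (hZ : Measurable[X.preAction k ⟨0, hH⟩] Z) (hZb : ∃ b, ∀ᵐ ω ∂μ, |Z ω| ≤ b) :
    ∑ h, ∫ ω, Z ω * g ω h (X.state k h.castSucc ω) (X.action k h ω) ∂μ =
      ∫ ω, Z ω * expectedTotal M.P (policy p (X.counts ω) k) (g ω) s₁ ∂μ := by
  have hle : ∀ h : Fin H, X.preAction k ⟨0, hH⟩ ≤ X.preAction k h := fun h =>
    X.preAction_mono k (Fin.mk_le_of_le_val (Nat.zero_le _))
  rw [Finset.sum_congr rfl fun h _ => hX.integral_mul_realized hk h hb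
    (fun h' s a => (hg h' s a).mono (hle h) le_rfl) hg0 hgb (hZ.mono (hle h) le_rfl) hZb]
  rw [Finset.sum_sub_distrib]
  set I : Fin (H + 1) → ℝ := fun i => ∫ ω, Z ω * remainingTotal M.P (policy p (X.counts ω) k)
    (g ω) i (X.state k i ω) ∂μ with hI
  have h1 := Fin.sum_univ_castSucc I
  rw [Fin.sum_univ_succ I] at h1
  have h2 : I (Fin.last H) = 0 := by simp [hI, remainingTotal_last]
  have h3 : I 0 = ∫ ω, Z ω * expectedTotal M.P (policy p (X.counts ω) k) (g ω) s₁ ∂μ := by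
    simp only [hI, hX.state_init k hk]
    congr 1
    funext ω
    rw [remainingTotal_zero (isPolicy_policy p (X.counts ω) k).2]
  change ∑ h : Fin H, I h.castSucc - ∑ h : Fin H, I h.succ = _
  rw [← h3]
  linarith

/-- The sum over the episodes of the expected totals of predictable functions exceeds that of the
realized totals by little. -/
lemma measure_expected_sub_realized_le (hX : IsRun M s₁ p μ X) (hH : 0 < H) (hK : 0 < p.K)
    {g : ℕ → Ω → Fin H → S → A → ℝ} {b : ℝ} (hb : 0 < b)
    (hg : ∀ k, ∀ j ≤ k, ∀ h s a, Measurable[X.preAction k ⟨0, hH⟩] fun ω => g j ω h s a)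
    (hg0 : ∀ k ω h s a, 0 ≤ g k ω h s a) (hgb : ∀ k ω h s a, g k ω h s a ≤ b)
    {L : ℝ} (hL : 0 ≤ L) :
    μ.real {ω | H * b * (L * Real.sqrt p.K) ≤ ∑ k ∈ Finset.range p.K,
      (expectedTotal M.P (policy p (X.counts ω) k) (g k ω) s₁ -
        ∑ h, g k ω h (X.state k h.castSucc ω) (X.action k h ω))} ≤
      Real.exp (-(L ^ 2 / 2)) := by
  have hH' : (0 : ℝ) < H := by exact_mod_cast hH
  have hK' : (0 : ℝ) < p.K := by exact_mod_cast hK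
  have hHb : 0 < H * b := mul_pos hH' hb
  set E : ℕ → Ω → ℝ := fun k ω => expectedTotal M.P (policy p (X.counts ω) k) (g k ω) s₁ with hE
  set R : ℕ → Ω → ℝ := fun k ω =>
    ∑ h, g k ω h (X.state k h.castSucc ω) (X.action k h ω) with hR
  have hEm : ∀ k, ∀ j ≤ k, Measurable[X.preAction k ⟨0, hH⟩] (E j) := by
    intro k j hjk
    have : E j = fun ω => remainingTotal M.P (policy p (X.counts ω) j) (g j ω) 0 s₁ := by
      funext ω
      rw [remainingTotal_zero (isPolicy_policy p (X.counts ω) j).2]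
    rw [this]
    exact measurable_remainingTotal
      (fun h' s a => measurable_policy_preAction hjk _ h' s a) (hg k j hjk) 0 s₁
  have hRm : ∀ {m : MeasurableSpace Ω} (j : ℕ), (∀ h s a, Measurable fun ω => g j ω h s a) →
      (∀ i, Measurable (X.state j i)) → (∀ i, Measurable (X.action j i)) → Measurable (R j) := by
    intro m j h1 h2 h3
    exact Finset.measurable_sum _ fun h _ => measurable_eval_of_fintype (h3 h)
      (F := fun a ω => g j ω h (X.state j h.castSucc ω) a) fun a =>
        measurable_eval_of_fintype (h2 _) (F := fun s ω => g j ω h s a) fun s => h1 h s a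
  have hgm : ∀ k < p.K, ∀ h s a, Measurable fun ω => g k ω h s a := fun k hk h s a =>
    (hg k k le_rfl h s a).mono (hX.preAction_le hk _) le_rfl
  have hE0 : ∀ k ω, 0 ≤ E k ω ∧ E k ω ≤ H * b := by
    intro k ω
    have := remainingTotal_mem M.P_nonneg M.P_sum (isPolicy_policy p (X.counts ω) k)
      (hg0 k ω) (hgb k ω) 0 s₁
    rw [remainingTotal_zero (isPolicy_policy p (X.counts ω) k).2] at this
    simpa using this
  have hR0 : ∀ k ω, 0 ≤ R k ω ∧ R k ω ≤ H * b := by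
    intro k ω
    refine ⟨Finset.sum_nonneg fun h _ => hg0 _ _ _ _ _, ?_⟩
    calc _ ≤ ∑ _h : Fin H, b := Finset.sum_le_sum fun h _ => hgb _ _ _ _ _
      _ = _ := by simp
  have hEmeas : ∀ k < p.K, Measurable (E k) := fun k hk =>
    (hEm k k le_rfl).mono (hX.preAction_le hk _) le_rfl
  have hRmeas : ∀ k < p.K, Measurable (R k) := fun k hk =>
    hRm k (hgm k hk) (hX.measurable_state k hk) (hX.measurable_action k hk)
  -- One increment per episode: expected and realized totals both lie in [0, Hb], so their
  -- difference divided by Hb is bounded by 1. Nothing is frozen here, so `v` is 1.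
  have key := measure_sum_ge_le_of_orthogonal (μ := μ) (K := p.K)
    (G := fun k => X.preAction k ⟨0, hH⟩) (v := fun _ _ => 1)
    (Y := fun k ω => (E k ω - R k ω) / (H * b))
    (fun k hk => hX.preAction_le hk _) (fun _ _ => measurable_const) (fun _ _ => Or.inr rfl)
    (fun _ _ _ _ => measurable_const)
    (fun k _ j hjk => ((hEm k j hjk.le).sub (hRm j (hg k j hjk.le)
      (fun i => X.measurable_state_preAction_of_lt hjk _ i)
      (fun i => (X.measurable_action_cost_preAction_of_lt hjk _ i).1))).div_const _)
    (fun k hk => ((hEmeas k hk).sub (hRmeas k hk)).div_const _)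
    (fun k _ => Filter.Eventually.of_forall fun ω => by
      rw [abs_div, abs_of_pos hHb, div_le_one hHb, abs_le]
      have h1 := hE0 k ω
      have h2 := hR0 k ω
      exact ⟨by linarith, by linarith⟩)
    (fun k hk Z hZ hZb => by
      have h1 := hX.integral_mul_episode hk hH hb.le (hg k k le_rfl) (hg0 k) (hgb k) hZ hZb
      obtain ⟨B, hB⟩ := hZb
      have hZm : Measurable Z := hZ.mono (hX.preAction_le hk _) le_rfl
      have hint : ∀ {f : Ω → ℝ} {c : ℝ}, Measurable f → (∀ ω, 0 ≤ f ω ∧ f ω ≤ c) →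
          Integrable (fun ω => Z ω * f ω) μ := by
        intro f c hf hfc
        refine Integrable.of_bound (hZm.mul hf).aestronglyMeasurable (B * c) ?_
        filter_upwards [hB] with ω hω
        rw [norm_mul, Real.norm_eq_abs, Real.norm_eq_abs, abs_of_nonneg (hfc ω).1]
        exact mul_le_mul hω (hfc ω).2 (hfc ω).1 ((abs_nonneg _).trans hω)
      have hZR : ∫ ω, Z ω * R k ω ∂μ = ∫ ω, Z ω * E k ω ∂μ := by
        rw [← h1, ← integral_finsetSum]
        · simp only [hR, Finset.mul_sum]
        · intro h _
          refine hint (c := b) ?_ fun ω => ⟨hg0 _ _ _ _ _, hgb _ _ _ _ _⟩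
          exact measurable_eval_of_fintype (hX.measurable_action k hk h)
            (F := fun a ω => g k ω h (X.state k h.castSucc ω) a) fun a =>
              measurable_eval_of_fintype (hX.measurable_state k hk _)
                (F := fun s ω => g k ω h s a) fun s => hgm k hk h s a
      calc _ = ∫ ω, (Z ω * E k ω - Z ω * R k ω) / (H * b) ∂μ := by
            congr 1; funext ω; ring
        _ = 0 := by
            rw [integral_div, integral_sub (hint (hEmeas k hk) (hE0 k))
              (hint (hRmeas k hk) (hR0 k)), hZR, sub_self, zero_div])
    hK' (mul_nonneg hL (Real.sqrt_nonneg p.K)) (fun ω => by simp)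
  rw [mul_pow, Real.sq_sqrt hK'.le, show L ^ 2 * p.K / (2 * p.K) = L ^ 2 / 2 by field_simp] at key
  refine le_trans (le_of_eq ?_) key
  congr 1
  ext ω
  simp only [Set.mem_ofPred_eq]
  rw [← Finset.sum_div, le_div_iff₀ hHb, mul_comm]

end IsRun

/-! ### Sums of exploration bonuses along a run -/

section VisitSums

/-- For n ≥ 1, √(n+1) ≤ 2√n and √(n+1) − √n = 1/(√(n+1) + √n). The constant 3 also covers n = 0. -/
lemma one_div_sqrt_max_le (n : ℕ) :
    1 / Real.sqrt (max 1 (n : ℝ)) ≤ 3 * (Real.sqrt ((n : ℝ) + 1) - Real.sqrt n) := by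
  rcases Nat.eq_zero_or_pos n with rfl | hn
  · norm_num
  · have hn' : (1 : ℝ) ≤ n := by exact_mod_cast hn
    rw [max_eq_right hn']
    have h0 : 0 < Real.sqrt n := Real.sqrt_pos.2 (by linarith)
    have h1 : Real.sqrt ((n : ℝ) + 1) ≤ 2 * Real.sqrt n := by
      rw [show (2 : ℝ) * Real.sqrt n = Real.sqrt (4 * n) by
        rw [Real.sqrt_mul (by norm_num), show (4 : ℝ) = 2 ^ 2 by norm_num,
          Real.sqrt_sq (by norm_num)]]
      exact Real.sqrt_le_sqrt (by linarith)
    have h2 := Real.sq_sqrt (by linarith : (0 : ℝ) ≤ n)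
    have h3 := Real.sq_sqrt (by linarith : (0 : ℝ) ≤ (n : ℝ) + 1)
    have h4 : Real.sqrt n ≤ Real.sqrt ((n : ℝ) + 1) := Real.sqrt_le_sqrt (by linarith)
    rw [div_le_iff₀ h0]
    have h5 : (Real.sqrt ((n : ℝ) + 1) - Real.sqrt n) *
      (Real.sqrt ((n : ℝ) + 1) + Real.sqrt n) = 1 := by nlinarith
    nlinarith

/-- The increment of the logarithm is at least 1/(n+2), and n + 2 ≤ 3 max(1, n). The shift makes the
telescoping sum start at log 1 = 0. -/
lemma one_div_max_le (n : ℕ) :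
    1 / max 1 (n : ℝ) ≤ 3 * (Real.log ((n : ℝ) + 2) - Real.log ((n : ℝ) + 1)) := by
  have hn : (0 : ℝ) ≤ n := Nat.cast_nonneg _
  rw [← Real.log_div (by linarith) (by linarith)]
  have h1 := Real.one_sub_inv_le_log_of_pos
    (by positivity : 0 < ((n : ℝ) + 2) / ((n : ℝ) + 1))
  have h2 : 1 - (((n : ℝ) + 2) / ((n : ℝ) + 1))⁻¹ = 1 / ((n : ℝ) + 2) := by
    field_simp; ring
  rw [h2] at h1
  refine le_trans ?_ (mul_le_mul_of_nonneg_left h1 (by norm_num))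
  rw [mul_one_div, div_le_div_iff₀ (by positivity) (by positivity)]
  nlinarith [le_max_left (1 : ℝ) n, le_max_right (1 : ℝ) n]

variable (b : ℕ → Prop) [DecidablePred b]

lemma sum_visits_one_div_sqrt_le (K : ℕ) :
    ∑ j ∈ Finset.range K, (if b j then 1 / Real.sqrt (max 1 (Nat.count b j : ℝ)) else 0) ≤
      3 * Real.sqrt (Nat.count b K) := by
  induction K with
  | zero => simp
  | succ K ih =>
    rw [Finset.sum_range_succ, Nat.count_succ]
    by_cases hb : b K
    · have := one_div_sqrt_max_le (Nat.count b K)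
      simp only [hb, if_true]
      push_cast
      linarith
    · simpa [hb] using ih

lemma sum_visits_one_div_le (K : ℕ) :
    ∑ j ∈ Finset.range K, (if b j then 1 / max 1 (Nat.count b j : ℝ) else 0) ≤
      3 * Real.log ((Nat.count b K : ℝ) + 1) := by
  induction K with
  | zero => simp
  | succ K ih =>
    rw [Finset.sum_range_succ, Nat.count_succ]
    by_cases hb : b K
    · have := one_div_max_le (Nat.count b K)
      simp only [hb, if_true]
      push_cast
      rw [show (Nat.count b K : ℝ) + 1 + 1 = Nat.count b K + 2 by ring]
      linarith
    · simpa [hb] using ih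

variable {S A : Type*} [Fintype S] [Fintype A] {H : ℕ} {Ω : Type*}

/-- Adding E₁ to an accurate private count never leaves it below the true one, so the bonus is at
most its analogue with true counts. -/
lemma bonus_le {p : Params} (h₁ : 0 ≤ p.E₁) (h₂ : 0 ≤ p.E₂) {n : Counts S A H} {h : Fin H} {s : S}
    {a : A} {N : ℝ} (hN : |n.N h s a - N| ≤ p.E₁) :
    bonus p n h s a ≤ (Lc S A H p + H * Lp S A H p) * (1 / Real.sqrt (max 1 N)) +
      (3 * p.E₁ + H * (Fintype.card S * p.E₂ + 2 * p.E₁)) * (1 / max 1 N) := by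
  have hD := le_den hN
  have h0 : (0 : ℝ) < max 1 N := lt_max_of_lt_left one_pos
  have hs : 0 < Real.sqrt (max 1 N) := Real.sqrt_pos.2 h0
  have h3 : 1 / den p n h s a ≤ 1 / max 1 N := one_div_le_one_div_of_le h0 hD
  have h4 : 1 / Real.sqrt (den p n h s a) ≤ 1 / Real.sqrt (max 1 N) :=
    one_div_le_one_div_of_le hs (Real.sqrt_le_sqrt hD)
  have hc : 0 ≤ Lc S A H p := Real.sqrt_nonneg _
  have hp : 0 ≤ Lp S A H p := Real.sqrt_nonneg _
  have e : bonus p n h s a = (Lc S A H p + H * Lp S A H p) * (1 / Real.sqrt (den p n h s a)) +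
      (3 * p.E₁ + H * (Fintype.card S * p.E₂ + 2 * p.E₁)) * (1 / den p n h s a) := by
    unfold bonus bonusC bonusP
    ring
  rw [e]
  exact add_le_add (mul_le_mul_of_nonneg_left h4 (by positivity))
    (mul_le_mul_of_nonneg_left h3 (by positivity))

variable [DecidableEq S] [DecidableEq A]

lemma Interaction.sum_trueN (X : Interaction S A H Ω) (K : ℕ) (ω : Ω) (h : Fin H) :
    ∑ s, ∑ a, X.trueN K ω h s a = K := by
  simp only [Interaction.trueN]
  simp_rw [Finset.sum_comm (t := Finset.range K)]
  have : ∀ j, (∑ s, ∑ a, if X.state j h.castSucc ω = s ∧ X.action j h ω = a then (1 : ℝ) else 0)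
      = 1 := by
    intro j
    simp [ite_and]
  rw [Finset.sum_congr rfl fun j _ => this j]
  simp

omit [Fintype A] in
lemma Interaction.sum_trueNS (X : Interaction S A H Ω) (k : ℕ) (ω : Ω) (h : Fin H) (s : S)
    (a : A) : ∑ s', X.trueNS k ω h s a s' = X.trueN k ω h s a := by
  simp only [Interaction.trueN, Interaction.trueNS]
  rw [Finset.sum_comm]
  simp [ite_and]

/-- Cauchy–Schwarz over the HSA cells, whose counts add up to KH. -/
lemma Interaction.sum_sqrt_trueN_le (X : Interaction S A H Ω) (K : ℕ) (ω : Ω) :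
    ∑ h, ∑ s, ∑ a, Real.sqrt (X.trueN K ω h s a) ≤
      Real.sqrt (H * Fintype.card S * Fintype.card A * (K * H)) := by
  have h0 : ∀ h s a, 0 ≤ X.trueN K ω h s a := fun h s a => by
    rw [X.trueN_eq_count]; exact Nat.cast_nonneg _
  have h1 := sq_sum_le_card_mul_sum_sq (s := (Finset.univ : Finset (Fin H × S × A)))
    (f := fun x => Real.sqrt (X.trueN K ω x.1 x.2.1 x.2.2))
  simp only [Real.sq_sqrt (h0 _ _ _)] at h1
  rw [Fintype.sum_prod_type, Fintype.sum_prod_type] at h1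
  simp only [Fintype.sum_prod_type, X.sum_trueN] at h1
  refine Real.le_sqrt_of_sq_le (h1.trans (le_of_eq ?_))
  simp
  ring

/-- Total exploration bonus collected along a run with accurate counts. -/
lemma sum_realized_bonus_le {p : Params} (h₁ : 0 ≤ p.E₁) (h₂ : 0 ≤ p.E₂)
    (X : Interaction S A H Ω) (ω : Ω)
    (hN : ∀ k < p.K, ∀ h s a, |X.privN k ω h s a - X.trueN k ω h s a| ≤ p.E₁) :
    ∑ k ∈ Finset.range p.K, ∑ h, bonus p (X.counts ω k) h (X.state k h.castSucc ω)
        (X.action k h ω) ≤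
      3 * (Lc S A H p + H * Lp S A H p) *
          Real.sqrt (H * Fintype.card S * Fintype.card A * (p.K * H)) +
        3 * (3 * p.E₁ + H * (Fintype.card S * p.E₂ + 2 * p.E₁)) *
          (H * Fintype.card S * Fintype.card A * Real.log (p.K + 1)) := by
  have hc : 0 ≤ Lc S A H p := Real.sqrt_nonneg _
  have hp : 0 ≤ Lp S A H p := Real.sqrt_nonneg _
  set α := Lc S A H p + H * Lp S A H p with hα
  set γ := 3 * p.E₁ + H * (Fintype.card S * p.E₂ + 2 * p.E₁) with hγ
  have hα0 : 0 ≤ α := by positivity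
  have hγ0 : 0 ≤ γ := by positivity
  have hcell : ∀ h s a, ∑ k ∈ Finset.range p.K,
      (if X.state k h.castSucc ω = s ∧ X.action k h ω = a then bonus p (X.counts ω k) h s a
        else 0) ≤
      α * (3 * Real.sqrt (X.trueN p.K ω h s a)) + γ * (3 * Real.log (p.K + 1)) := by
    intro h s a
    have hs := sum_visits_one_div_sqrt_le
      (fun j => X.state j h.castSucc ω = s ∧ X.action j h ω = a) p.K
    have hl := sum_visits_one_div_le
      (fun j => X.state j h.castSucc ω = s ∧ X.action j h ω = a) p.K
    have hle : ((Nat.count (fun j => X.state j h.castSucc ω = s ∧ X.action j h ω = a) p.K : ℕ) : ℝ)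
        ≤ p.K := by exact_mod_cast Nat.count_le _
    have hlog := Real.log_le_log (by positivity) (add_le_add_left hle 1)
    rw [X.trueN_eq_count]
    refine le_trans ?_ (add_le_add (mul_le_mul_of_nonneg_left hs hα0)
      (mul_le_mul_of_nonneg_left (hl.trans (mul_le_mul_of_nonneg_left hlog (by norm_num))) hγ0))
    rw [Finset.mul_sum, Finset.mul_sum, ← Finset.sum_add_distrib]
    refine Finset.sum_le_sum fun k hk => ?_
    split_ifs with hv
    · have := bonus_le h₁ h₂ (n := X.counts ω k) (hN k (Finset.mem_range.1 hk) h s a)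
      rwa [X.trueN_eq_count] at this
    · simp
  -- Regrouping by cell: each step of each episode visits exactly one pair.
  have hsplit : ∑ k ∈ Finset.range p.K, ∑ h, bonus p (X.counts ω k) h (X.state k h.castSucc ω)
        (X.action k h ω) = ∑ h, ∑ s, ∑ a, ∑ k ∈ Finset.range p.K,
      (if X.state k h.castSucc ω = s ∧ X.action k h ω = a then bonus p (X.counts ω k) h s a
        else 0) := by
    rw [Finset.sum_comm]
    refine Finset.sum_congr rfl fun h _ => ?_
    simp_rw [Finset.sum_comm (t := Finset.range p.K)]
    refine Finset.sum_congr rfl fun k _ => ?_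
    simp [ite_and]
  rw [hsplit]
  refine (Finset.sum_le_sum fun h _ => Finset.sum_le_sum fun s _ => Finset.sum_le_sum fun a _ =>
    hcell h s a).trans ?_
  simp only [Finset.sum_add_distrib, ← Finset.mul_sum]
  have := mul_le_mul_of_nonneg_left (X.sum_sqrt_trueN_le p.K ω) hα0
  simp only [Finset.sum_const, Finset.card_univ, Fintype.card_fin, nsmul_eq_mul]
  linarith

end VisitSums

/-! ### The regret bound -/

section Arithmetic

/-- Uses 12 < e³. The constants 8 and 12 arise when the confidence level δ/2 is put into L_c and
L_p. -/
lemma log_const_mul_le {c x : ℝ} (hc : 0 < c) (hc' : c ≤ 12) (hx : 1 ≤ x) :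
    Real.log (c * x) ≤ 3 * (1 + Real.log x) := by
  have h0 := Real.log_nonneg hx
  have h1 : Real.log c ≤ 3 := by
    rw [Real.log_le_iff_le_exp hc]
    have h2 : (2.7 : ℝ) ^ 3 ≤ Real.exp 1 ^ 3 :=
      pow_le_pow_left₀ (by norm_num) (by linarith [Real.exp_one_gt_d9]) 3
    rw [← Real.exp_nat_mul] at h2
    norm_num at h2
    linarith
  rw [Real.log_mul hc.ne' (by linarith)]
  linarith

lemma sqrt_mul_log_le {c d x e : ℝ} (hc : 0 < c) (hc' : c ≤ 12) (hd : 0 ≤ d) (hx : 1 ≤ x)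
    (he : 0 ≤ e) (hed : 3 * d ≤ e ^ 2) :
    Real.sqrt (d * Real.log (c * x)) ≤ e * (1 + Real.log x) := by
  have h0 := Real.log_nonneg hx
  rw [Real.sqrt_le_iff]
  refine ⟨by positivity, ?_⟩
  calc d * Real.log (c * x) ≤ d * (3 * (1 + Real.log x)) :=
        mul_le_mul_of_nonneg_left (log_const_mul_le hc hc' hx) hd
    _ ≤ e ^ 2 * (1 + Real.log x) := by nlinarith
    _ ≤ e ^ 2 * (1 + Real.log x) ^ 2 :=
        mul_le_mul_of_nonneg_left (by nlinarith) (sq_nonneg e)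
    _ = _ := by ring

/-- Supplies the lower bounds on L_c and L_p that absorb the truncation of the denominator: log 8 ≥
7/8. -/
lemma one_le_sqrt_mul_log {c d x : ℝ} (hc : 8 ≤ c) (hd : 2 ≤ d) (hx : 1 ≤ x) :
    1 ≤ Real.sqrt (d * Real.log (c * x)) := by
  rw [Real.one_le_sqrt]
  have h1 : (8 : ℝ) ≤ c * x := by nlinarith
  have h2 := Real.one_sub_inv_le_log_of_pos (by linarith : 0 < c * x)
  have h3 : (c * x)⁻¹ ≤ 1 / 8 := by
    rw [one_div]
    exact inv_anti₀ (by norm_num) h1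
  nlinarith

/-- Each leading term is a multiple of yW, with total coefficient 2 + 3 + 6·7 = 47; the E₂ and E₁
terms get 6 and 30. All are at most 50. -/
lemma regret_terms_le {S A H K x E₁ E₂ lc lp l : ℝ} (hS : 1 ≤ S) (hA : 1 ≤ A) (hH : 1 ≤ H)
    (hK : 1 ≤ K) (hKx : K ≤ x) (h₁ : 0 ≤ E₁) (h₂ : 0 ≤ E₂)
    (hlc : lc ≤ 3 * (1 + Real.log x)) (hlp : lp ≤ 4 * Real.sqrt S * (1 + Real.log x))
    (hl : l ≤ 3 * (1 + Real.log x)) :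
    H * Real.sqrt (2 * H ^ 2 * K * Real.log A) + (H * H * (l * Real.sqrt K) +
      2 * (3 * (lc + H * lp) * Real.sqrt (H * S * A * (K * H)) +
        3 * (3 * E₁ + H * (S * E₂ + 2 * E₁)) * (H * S * A * Real.log (K + 1)))) ≤
      50 * (1 + Real.log x) * (Real.sqrt (S ^ 2 * A * H ^ 3 * (K * H)) +
        Real.sqrt (S ^ 3 * A ^ 2 * H ^ 4) + E₂ * S ^ 2 * A * H ^ 2 + E₁ * S * A * H ^ 2) := by
  have hy : 1 ≤ 1 + Real.log x := by linarith [Real.log_nonneg (hK.trans hKx)]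
  have hlogK : Real.log (K + 1) ≤ 1 + Real.log x := by
    have e1 : Real.log (K + 1) ≤ Real.log (2 * x) := Real.log_le_log (by linarith) (by linarith)
    rw [Real.log_mul (by norm_num) (by linarith)] at e1
    linarith [Real.log_two_lt_d9]
  set y := 1 + Real.log x
  set W := Real.sqrt (S ^ 2 * A * H ^ 3 * (K * H)) with hW
  have hW0 : 0 ≤ W := Real.sqrt_nonneg _
  have hy0 : 0 ≤ y := by linarith
  have t1 : H * Real.sqrt (2 * H ^ 2 * K * Real.log A) ≤ 2 * (y * W) := by
    have e1 : H * Real.sqrt (2 * H ^ 2 * K * Real.log A) =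
        Real.sqrt (H ^ 2 * (2 * H ^ 2 * K * Real.log A)) := by
      rw [Real.sqrt_mul (sq_nonneg H), Real.sqrt_sq (by linarith)]
    have e2 : 2 * W = Real.sqrt (2 ^ 2 * (S ^ 2 * A * H ^ 3 * (K * H))) := by
      rw [Real.sqrt_mul (by positivity), Real.sqrt_sq (by norm_num)]
    have e3 : H * Real.sqrt (2 * H ^ 2 * K * Real.log A) ≤ 2 * W := by
      rw [e1, e2]
      refine Real.sqrt_le_sqrt ?_
      have e4 : Real.log A ≤ A := (Real.log_le_sub_one_of_pos (by linarith)).trans (by linarith)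
      have e5 : (1 : ℝ) ≤ S ^ 2 := one_le_pow₀ hS
      have e6 : Real.log A ≤ S ^ 2 * A := by nlinarith
      calc H ^ 2 * (2 * H ^ 2 * K * Real.log A) = 2 * (H ^ 4 * K) * Real.log A := by ring
        _ ≤ 2 * (H ^ 4 * K) * (S ^ 2 * A) := mul_le_mul_of_nonneg_left e6 (by positivity)
        _ ≤ 4 * (H ^ 4 * K) * (S ^ 2 * A) := by
            have : 0 ≤ (H ^ 4 * K) * (S ^ 2 * A) := by positivity
            linarith
        _ = _ := by ring
    nlinarith
  have t2 : H * H * (l * Real.sqrt K) ≤ 3 * (y * W) := by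
    have e1 : H * H * Real.sqrt K ≤ W := by
      rw [hW, show H * H = Real.sqrt ((H * H) ^ 2) from (Real.sqrt_sq (by positivity)).symm,
        ← Real.sqrt_mul (by positivity)]
      refine Real.sqrt_le_sqrt ?_
      have e5 : (1 : ℝ) ≤ S ^ 2 * A := one_le_mul_of_one_le_of_one_le (one_le_pow₀ hS) hA
      have e6 : 0 ≤ H ^ 4 * K := by positivity
      nlinarith
    calc H * H * (l * Real.sqrt K) = l * (H * H * Real.sqrt K) := by ring
      _ ≤ (3 * y) * W := mul_le_mul hl e1 (by positivity) (by positivity)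
      _ = _ := by ring
  have t3 : (lc + H * lp) * Real.sqrt (H * S * A * (K * H)) ≤ 7 * (y * W) := by
    have hsS : 1 ≤ Real.sqrt S := Real.one_le_sqrt.2 hS
    have e1 : lc + H * lp ≤ 7 * y * (H * Real.sqrt S) := by
      have e2 : lc ≤ 3 * y * (H * Real.sqrt S) := by
        refine hlc.trans (le_mul_of_one_le_right (by positivity) ?_)
        exact one_le_mul_of_one_le_of_one_le hH hsS
      have e3 := mul_le_mul_of_nonneg_left hlp (by linarith : 0 ≤ H)
      linarith
    have e4 : H * Real.sqrt S * Real.sqrt (H * S * A * (K * H)) = W := by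
      rw [hW, mul_assoc, ← Real.sqrt_mul (by linarith)]
      nth_rewrite 1 [show H = Real.sqrt (H ^ 2) from (Real.sqrt_sq (by linarith)).symm]
      rw [← Real.sqrt_mul (by positivity)]
      congr 1
      ring
    calc _ ≤ 7 * y * (H * Real.sqrt S) * Real.sqrt (H * S * A * (K * H)) :=
          mul_le_mul_of_nonneg_right e1 (Real.sqrt_nonneg _)
      _ = 7 * (y * (H * Real.sqrt S * Real.sqrt (H * S * A * (K * H)))) := by ring
      _ = _ := by rw [e4]
  have t4 : (3 * E₁ + H * (S * E₂ + 2 * E₁)) * (H * S * A * Real.log (K + 1)) ≤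
      y * (E₂ * S ^ 2 * A * H ^ 2) + 5 * (y * (E₁ * S * A * H ^ 2)) := by
    have e1 : 3 * E₁ + H * (S * E₂ + 2 * E₁) ≤ H * (S * E₂ + 5 * E₁) := by nlinarith
    calc _ ≤ H * (S * E₂ + 5 * E₁) * (H * S * A * y) :=
          mul_le_mul e1 (mul_le_mul_of_nonneg_left hlogK (by positivity))
            (mul_nonneg (by positivity) (Real.log_nonneg (by linarith))) (by positivity)
      _ = _ := by ring
  have p1 : 0 ≤ y * W := mul_nonneg hy0 hW0
  have p2 : 0 ≤ y * Real.sqrt (S ^ 3 * A ^ 2 * H ^ 4) := mul_nonneg hy0 (Real.sqrt_nonneg _)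
  have p3 : 0 ≤ y * (E₂ * S ^ 2 * A * H ^ 2) := by positivity
  have p4 : 0 ≤ y * (E₁ * S * A * H ^ 2) := by positivity
  nlinarith

/-- The left side is (2/(12x)²)ⁿ with base below 1, so the factor n in the exponent absorbs the 2ⁿ
subsets. -/
lemma two_pow_mul_exp_le {x : ℝ} (hx : 1 ≤ x) {n : ℕ} (hn : 1 ≤ n) :
    2 ^ n * Real.exp (-(4 * n * Real.log (12 * x) / 2)) ≤ 1 / (72 * x) := by
  have hx0 : 0 < 12 * x := by linarith
  have h1 : Real.exp (-(4 * n * Real.log (12 * x) / 2)) = (((12 * x) ^ 2)⁻¹) ^ n := by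
    rw [show -(4 * n * Real.log (12 * x) / 2) = n * -(2 * Real.log (12 * x)) by ring,
      Real.exp_nat_mul, Real.exp_neg, show 2 * Real.log (12 * x) =
        (2 : ℕ) * Real.log (12 * x) by norm_num, Real.exp_nat_mul, Real.exp_log hx0]
  rw [h1, ← mul_pow]
  have h2 : 2 * ((12 * x) ^ 2)⁻¹ ≤ 1 / (72 * x) := by
    rw [← div_eq_mul_inv, div_le_div_iff₀ (by positivity) (by positivity)]
    nlinarith
  have h3 : 1 / (72 * x) ≤ 1 := by
    rw [div_le_one (by positivity)]; linarith
  exact (pow_le_of_le_one (by positivity) (h2.trans h3) (by omega)).trans h2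

end Arithmetic

/-! ### From the concentration events to the regret bound -/

section Main

variable {S A : Type*} [Fintype S] [Fintype A] [DecidableEq S] [DecidableEq A] [Nonempty A] {H : ℕ}
  {Ω : Type*}

/-- On accurate counts that concentrate around their means, the regret is controlled by the
exploration bonuses. -/
lemma regret_le_of_concentration (M : MDP S A H) (s₁ : S) (p : Params) (hK : 0 < p.K) (hH : 0 < H)
    (hη : p.η = Real.sqrt (2 * Real.log (Fintype.card A) / ((H : ℝ) ^ 2 * p.K)))
    (hLc : 1 ≤ Lc S A H p) (hLp : 1 ≤ Lp S A H p) (X : Interaction S A H Ω) (ω : Ω)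
    (hacc : ∀ k < p.K, ∀ h s a,
      |X.privN k ω h s a - X.trueN k ω h s a| ≤ p.E₁ ∧
      |X.privC k ω h s a - X.trueC k ω h s a| ≤ p.E₁ ∧
      ∀ s', |X.privNS k ω h s a s' - X.trueNS k ω h s a s'| ≤ p.E₂)
    (hcost : ∀ k < p.K, ∀ h s a, |X.trueC k ω h s a - X.trueN k ω h s a * M.c h s a| ≤
      Lc S A H p * Real.sqrt (X.trueN k ω h s a))
    (htrans : ∀ k < p.K, ∀ h s a, ∀ B : Finset S,
      ∑ s' ∈ B, (X.trueNS k ω h s a s' - X.trueN k ω h s a * M.P h s a s') ≤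
      Lp S A H p * Real.sqrt (X.trueN k ω h s a)) :
    regret M s₁ p X ω ≤ H * Real.sqrt (2 * (H : ℝ) ^ 2 * p.K * Real.log (Fintype.card A)) +
      ∑ k ∈ Finset.range p.K, expectedTotal M.P (policy p (X.counts ω) k)
        (fun h s a => min (2 * bonus p (X.counts ω k) h s a) H) s₁ := by
  have hc : ∀ k < p.K, ∀ h s a, |costEst p (X.counts ω k) h s a - M.c h s a| ≤
      bonusC p (X.counts ω k) h s a := fun k hk h s a =>
    abs_costEst_sub_le (X.trueN_eq_zero_or_one_le k ω h s a) (hacc k hk h s a).1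
      (hacc k hk h s a).2.1 hLc (hcost k hk h s a) (M.c_nonneg _ _ _) (M.c_le_one _ _ _)
  have hp : ∀ k < p.K, ∀ h s a,
      |∑ s', vEst p (X.counts ω k) (policy p (X.counts ω) k) h.succ s' *
          transEst p (X.counts ω k) h s a s' -
        ∑ s', M.P h s a s' * vEst p (X.counts ω k) (policy p (X.counts ω) k) h.succ s'| ≤
      H * bonusP p (X.counts ω k) h s a := fun k hk h s a =>
    abs_transEst_sub_le (X.trueN_eq_zero_or_one_le k ω h s a) (hacc k hk h s a).1
      (hacc k hk h s a).2.2 (X.sum_trueNS k ω h s a) (M.P_nonneg h s a) (M.P_sum h s a)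
      (vEst_nonneg _ _ (isPolicy_policy _ _ _) _)
      (fun s' => (vEst_le _ _ (isPolicy_policy _ _ _) _ s').trans
        (sub_le_self _ (Nat.cast_nonneg _))) hLp (htrans k hk h s a)
  exact regret_le M p hK X ω s₁ fun ρ hρ => sum_value_sub_le M p hK hH hη (X.counts ω)
    (fun k h s a => min (2 * bonus p (X.counts ω k) h s a) H)
    (fun k hk h s a => qEst_optimistic M (isPolicy_policy _ _ _) (hc k hk h s a) (hp k hk h s a))
    (fun k hk h s a => qEst_pessimistic M (isPolicy_policy _ _ _) (hc k hk h s a) (hp k hk h s a))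
    hρ s₁

/-- High-probability regret bound of the algorithm with accurate private counts. -/
lemma IsRun.regret_bound [MeasurableSpace S] [DiscreteMeasurableSpace S] [MeasurableSpace A]
    [DiscreteMeasurableSpace A] [MeasurableSpace Ω] {M : MDP S A H} {s₁ : S} {p : Params}
    {μ : Measure Ω} [IsProbabilityMeasure μ] {X : Interaction S A H Ω} (hX : IsRun M s₁ p μ X)
    (hK : 0 < p.K) (hH : 0 < H) {δ : ℝ} (hδ : 0 < δ) (hδ1 : δ ≤ 1) (hpδ : p.δ = δ / 2)
    (h₁ : 0 < p.E₁) (h₂ : 0 < p.E₂)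
    (hη : p.η = Real.sqrt (2 * Real.log (Fintype.card A) / ((H : ℝ) ^ 2 * p.K)))
    (hacc : AccurateCounts p.K (δ / 2) p.E₁ p.E₂ μ X) :
    1 - δ ≤ μ.real {ω | regret M s₁ p X ω ≤
      50 * (1 + Real.log (Fintype.card S * Fintype.card A * ((p.K : ℝ) * H) / δ)) *
        (Real.sqrt ((Fintype.card S : ℝ) ^ 2 * Fintype.card A * (H : ℝ) ^ 3 * ((p.K : ℝ) * H))
          + Real.sqrt ((Fintype.card S : ℝ) ^ 3 * (Fintype.card A : ℝ) ^ 2 * (H : ℝ) ^ 4)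
          + p.E₂ * (Fintype.card S : ℝ) ^ 2 * Fintype.card A * (H : ℝ) ^ 2
          + p.E₁ * Fintype.card S * Fintype.card A * (H : ℝ) ^ 2)} := by
  have hSn : 1 ≤ Fintype.card S := Fintype.card_pos_iff.2 ⟨s₁⟩
  have hAn : 1 ≤ Fintype.card A := Fintype.card_pos
  have hS : (1 : ℝ) ≤ Fintype.card S := by exact_mod_cast hSn
  have hA : (1 : ℝ) ≤ Fintype.card A := by exact_mod_cast hAn
  have hH1 : (1 : ℝ) ≤ H := by exact_mod_cast hH
  have hK1 : (1 : ℝ) ≤ p.K := by exact_mod_cast hK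
  set x : ℝ := Fintype.card S * Fintype.card A * ((p.K : ℝ) * H) / δ with hx
  have hKx : (p.K : ℝ) ≤ x := by
    rw [hx, le_div_iff₀ hδ]
    calc (p.K : ℝ) * δ ≤ p.K := mul_le_of_le_one_right (by linarith) hδ1
      _ ≤ p.K * H := le_mul_of_one_le_right (by linarith) hH1
      _ ≤ _ := le_mul_of_one_le_left (by positivity) (one_le_mul_of_one_le_of_one_le hS hA)
  have hx1 : 1 ≤ x := hK1.trans hKx
  have hδx : 1 / δ ≤ x := by
    rw [hx]
    refine div_le_div_of_nonneg_right ?_ hδ.le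
    exact one_le_mul_of_one_le_of_one_le (one_le_mul_of_one_le_of_one_le hS hA)
      (one_le_mul_of_one_le_of_one_le hK1 hH1)
  have hLc : Lc S A H p = Real.sqrt (2 * Real.log (8 * x)) := by
    rw [Lc, hpδ]
    congr 3
    rw [hx]
    field_simp
    norm_num
  have hLp : Lp S A H p = Real.sqrt (4 * Fintype.card S * Real.log (12 * x)) := by
    rw [Lp, hpδ]
    congr 3
    rw [hx]
    field_simp
    norm_num
  have hLc1 : 1 ≤ Lc S A H p := by
    rw [hLc]; exact one_le_sqrt_mul_log (by norm_num) le_rfl hx1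
  have hLp1 : 1 ≤ Lp S A H p := by
    rw [hLp]; exact one_le_sqrt_mul_log (by norm_num) (by linarith) hx1
  -- Chosen so that exp(−l²/2) = δ/8; a single event is excluded, so no union bound enters.
  set l : ℝ := Real.sqrt (2 * Real.log (8 * (1 / δ))) with hl
  have h1δ : 1 ≤ 1 / δ := by rw [le_div_iff₀ hδ]; linarith
  have hl3 : l ≤ 3 * (1 + Real.log x) := by
    refine (sqrt_mul_log_le (e := 3) (by norm_num) (by norm_num) (by norm_num) h1δ (by norm_num)
      (by norm_num)).trans ?_
    have := Real.log_le_log (by positivity) hδx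
    linarith
  have hLc3 : Lc S A H p ≤ 3 * (1 + Real.log x) := by
    rw [hLc]
    exact sqrt_mul_log_le (by norm_num) (by norm_num) (by norm_num) hx1 (by norm_num)
      (by norm_num)
  have hLp3 : Lp S A H p ≤ 4 * Real.sqrt (Fintype.card S) * (1 + Real.log x) := by
    rw [hLp]
    refine sqrt_mul_log_le (by norm_num) (by norm_num) (by positivity) hx1 (by positivity) ?_
    rw [mul_pow, Real.sq_sqrt (by linarith)]
    linarith
  set g : ℕ → Ω → Fin H → S → A → ℝ :=
    fun k ω h s a => min (2 * bonus p (X.counts ω k) h s a) H with hg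
  set badC : Fin H × S × A → Set Ω := fun i => {ω | ∃ k < p.K,
    Lc S A H p * Real.sqrt (X.trueN k ω i.1 i.2.1 i.2.2) <
      |X.trueC k ω i.1 i.2.1 i.2.2 - X.trueN k ω i.1 i.2.1 i.2.2 * M.c i.1 i.2.1 i.2.2|} with hbadC
  set badP : Fin H × S × A → Set Ω := fun i => {ω | ∃ k < p.K, ∃ B : Finset S,
    Lp S A H p * Real.sqrt (X.trueN k ω i.1 i.2.1 i.2.2) <
      ∑ s' ∈ B, (X.trueNS k ω i.1 i.2.1 i.2.2 s' -
        X.trueN k ω i.1 i.2.1 i.2.2 * M.P i.1 i.2.1 i.2.2 s')} with hbadP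
  set badE : Set Ω := {ω | H * H * (l * Real.sqrt p.K) ≤ ∑ k ∈ Finset.range p.K,
      (expectedTotal M.P (policy p (X.counts ω) k) (g k ω) s₁ -
        ∑ h, g k ω h (X.state k h.castSucc ω) (X.action k h ω))} with hbadE
  set bad : Set Ω := ((⋃ i ∈ (Finset.univ : Finset (Fin H × S × A)), badC i) ∪
    ⋃ i ∈ (Finset.univ : Finset (Fin H × S × A)), badP i) ∪ badE with hbad
  -- The union bounds run over HSA cells and up to K visit numbers, SAT = δx in all.
  have hcard : ((Finset.univ : Finset (Fin H × S × A)).card : ℝ) * p.K = δ * x := by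
    rw [hx]
    simp
    field_simp
  have hPC : μ.real (⋃ i ∈ (Finset.univ : Finset (Fin H × S × A)), badC i) ≤ δ / 4 := by
    refine (measureReal_biUnion_finset_le _ _).trans ((Finset.sum_le_sum fun i _ =>
      hX.measure_cost_deviation_le i.1 i.2.1 i.2.2 (zero_le_one.trans hLc1)).trans ?_)
    have e : Real.exp (-(Lc S A H p ^ 2 / 2)) = 1 / (8 * x) := by
      rw [hLc, Real.sq_sqrt (mul_nonneg (by norm_num) (Real.log_nonneg (by linarith))),
        mul_div_cancel_left₀ _ (by norm_num), Real.exp_neg, Real.exp_log (by linarith), one_div]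
    rw [Finset.sum_const, nsmul_eq_mul, e]
    refine le_of_eq ?_
    calc _ = ((Finset.univ : Finset (Fin H × S × A)).card : ℝ) * p.K * (2 * (1 / (8 * x))) := by
          ring
      _ = δ / 4 := by rw [hcard]; field_simp; norm_num
  have hPP : μ.real (⋃ i ∈ (Finset.univ : Finset (Fin H × S × A)), badP i) ≤ δ / 72 := by
    refine (measureReal_biUnion_finset_le _ _).trans ((Finset.sum_le_sum fun i _ =>
      hX.measure_transition_deviation_le i.1 i.2.1 i.2.2 (zero_le_one.trans hLp1)).trans ?_)
    have e : 2 ^ Fintype.card S * Real.exp (-(Lp S A H p ^ 2 / 2)) ≤ 1 / (72 * x) := by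
      rw [hLp, Real.sq_sqrt (mul_nonneg (by positivity) (Real.log_nonneg (by linarith)))]
      exact two_pow_mul_exp_le hx1 hSn
    rw [Finset.sum_const, nsmul_eq_mul]
    calc _ = ((Finset.univ : Finset (Fin H × S × A)).card : ℝ) * p.K *
            (2 ^ Fintype.card S * Real.exp (-(Lp S A H p ^ 2 / 2))) := by ring
      _ ≤ ((Finset.univ : Finset (Fin H × S × A)).card : ℝ) * p.K * (1 / (72 * x)) :=
          mul_le_mul_of_nonneg_left e (by positivity)
      _ = δ / 72 := by rw [hcard]; field_simp
  have hg0 : ∀ k ω h s a, 0 ≤ g k ω h s a := fun k ω h s a =>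
    le_min (mul_nonneg (by norm_num) (bonus_nonneg h₁.le h₂.le _ _ _ _)) (Nat.cast_nonneg _)
  have hPE : μ.real badE ≤ δ / 8 := by
    refine (hX.measure_expected_sub_realized_le hH hK (b := H) (by linarith)
      (fun k j hjk h s a => Measurable.min
        (((X.measurableCounts_preAction hjk _).bonus p h s a).const_mul 2) measurable_const)
      hg0 (fun _ _ _ _ _ => min_le_right _ _) (Real.sqrt_nonneg _)).trans (le_of_eq ?_)
    rw [Real.sq_sqrt (mul_nonneg (by norm_num) (Real.log_nonneg (by linarith))),
      mul_div_cancel_left₀ _ (by norm_num), Real.exp_neg, Real.exp_log (by linarith)]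
    field_simp
  -- δ/4 + δ/72 + δ/8 ≤ δ/2; the other half of δ is left for inaccurate counts.
  have hPbad : μ.real bad ≤ δ / 2 := by
    have e1 := measureReal_union_le (μ := μ)
      ((⋃ i ∈ (Finset.univ : Finset (Fin H × S × A)), badC i) ∪
        ⋃ i ∈ (Finset.univ : Finset (Fin H × S × A)), badP i) badE
    have e2 := measureReal_union_le (μ := μ)
      (⋃ i ∈ (Finset.univ : Finset (Fin H × S × A)), badC i)
      (⋃ i ∈ (Finset.univ : Finset (Fin H × S × A)), badP i)
    linarith
  rw [AccurateCounts] at hacc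
  set acc : Set Ω := {ω | ∀ k < p.K, ∀ h s a,
    |X.privN k ω h s a - X.trueN k ω h s a| ≤ p.E₁ ∧
    |X.privC k ω h s a - X.trueC k ω h s a| ≤ p.E₁ ∧
    ∀ s', |X.privNS k ω h s a s' - X.trueNS k ω h s a s'| ≤ p.E₂} with hAcc
  -- A covering rather than a passage to complements: subadditivity then suffices and no
  -- measurability of these events is needed.
  have hcover : acc ⊆ {ω | regret M s₁ p X ω ≤ 50 * (1 + Real.log x) *
        (Real.sqrt ((Fintype.card S : ℝ) ^ 2 * Fintype.card A * (H : ℝ) ^ 3 * ((p.K : ℝ) * H))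
          + Real.sqrt ((Fintype.card S : ℝ) ^ 3 * (Fintype.card A : ℝ) ^ 2 * (H : ℝ) ^ 4)
          + p.E₂ * (Fintype.card S : ℝ) ^ 2 * Fintype.card A * (H : ℝ) ^ 2
          + p.E₁ * Fintype.card S * Fintype.card A * (H : ℝ) ^ 2)} ∪ bad := by
    intro ω hω
    by_cases hb : ω ∈ bad
    · exact Or.inr hb
    refine Or.inl ?_
    have hbC : ∀ i, ω ∉ badC i := fun i hi =>
      hb (Or.inl (Or.inl (Set.mem_biUnion (Finset.mem_univ i) hi)))
    have hbP : ∀ i, ω ∉ badP i := fun i hi =>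
      hb (Or.inl (Or.inr (Set.mem_biUnion (Finset.mem_univ i) hi)))
    have hbE : ω ∉ badE := fun hi => hb (Or.inr hi)
    have hreg := regret_le_of_concentration M s₁ p hK hH hη hLc1 hLp1 X ω hω
      (fun k hk h s a => le_of_not_gt fun hlt => hbC (h, s, a) ⟨k, hk, hlt⟩)
      (fun k hk h s a B => le_of_not_gt fun hlt => hbP (h, s, a) ⟨k, hk, B, hlt⟩)
    have hE : ∑ k ∈ Finset.range p.K,
      (expectedTotal M.P (policy p (X.counts ω) k) (g k ω) s₁ -
        ∑ h, g k ω h (X.state k h.castSucc ω) (X.action k h ω)) <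
        H * H * (l * Real.sqrt p.K) := not_le.1 hbE
    rw [Finset.sum_sub_distrib] at hE
    have hreal : ∑ k ∈ Finset.range p.K, ∑ h, g k ω h (X.state k h.castSucc ω) (X.action k h ω) ≤
        2 * ∑ k ∈ Finset.range p.K, ∑ h, bonus p (X.counts ω k) h (X.state k h.castSucc ω)
          (X.action k h ω) := by
      simp only [Finset.mul_sum]
      exact Finset.sum_le_sum fun k _ => Finset.sum_le_sum fun h _ => min_le_left _ _
    have hbon := sum_realized_bonus_le h₁.le h₂.le X ω fun k hk h s a => (hω k hk h s a).1
    have hfin := regret_terms_le hS hA hH1 hK1 hKx h₁.le h₂.le hLc3 hLp3 hl3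
    refine le_trans ?_ hfin
    change regret M s₁ p X ω ≤ _ + ∑ k ∈ Finset.range p.K,
      expectedTotal M.P (policy p (X.counts ω) k) (g k ω) s₁ at hreg
    linarith
  have e1 := (measureReal_mono (μ := μ) hcover).trans (measureReal_union_le _ _)
  linarith

end Main

end PrivateRL

end

open PrivateRL MeasureTheory in
theorem theorem1 :
    ∃ (C : ℝ) (q : ℕ), 0 < C ∧
      ∀ (S A : Type*) [Fintype S] [Fintype A] [DecidableEq S] [DecidableEq A] [Nonempty A]
        [MeasurableSpace S] [DiscreteMeasurableSpace S]
        [MeasurableSpace A] [DiscreteMeasurableSpace A]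
        (H K : ℕ) (_ : 0 < H) (_ : 0 < K) (M : MDP S A H) (s₁ : S)
        (ε δ : ℝ) (_ : 0 < ε) (_ : 0 < δ) (_ : δ ≤ 1)
        (E₁ E₂ : ℝ → ℝ → ℝ) (_ : 0 < E₁ ε (δ / 2)) (_ : 0 < E₂ ε (δ / 2))
        (p : Params)
        (_ : p = { K := K, δ := δ / 2, E₁ := E₁ ε (δ / 2), E₂ := E₂ ε (δ / 2),
                   η := Real.sqrt (2 * Real.log (Fintype.card A) / ((H : ℝ) ^ 2 * K)) })
        (Ω : Type*) [MeasurableSpace Ω] (μ : Measure Ω) [IsProbabilityMeasure μ]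
        (X : Interaction S A H Ω) (_ : IsRun M s₁ p μ X)
        (_ : AccurateCounts K (δ / 2) (E₁ ε (δ / 2)) (E₂ ε (δ / 2)) μ X)
        (nS nA T : ℝ) (_ : nS = Fintype.card S) (_ : nA = Fintype.card A)
        (_ : T = (K : ℝ) * H),
        1 - δ ≤ μ.real {ω | regret M s₁ p X ω ≤
          C * (1 + Real.log (nS * nA * T / δ)) ^ q *
            (Real.sqrt (nS ^ 2 * nA * (H : ℝ) ^ 3 * T)
              + Real.sqrt (nS ^ 3 * nA ^ 2 * (H : ℝ) ^ 4)
              + E₂ ε (δ / 2) * nS ^ 2 * nA * (H : ℝ) ^ 2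
              + E₁ ε (δ / 2) * nS * nA * (H : ℝ) ^ 2)} := by
  refine ⟨50, 1, by norm_num, ?_⟩
  intro S A _ _ _ _ _ _ _ _ _ H K hH hK M s₁ ε δ _ hδ hδ1 E₁ E₂ hE₁ hE₂ p hp Ω _ μ _ X hX hacc
    nS nA T hnS hnA hT
  subst hp hnS hnA hT
  rw [pow_one]
  exact hX.regret_bound hK hH hδ hδ1 rfl hE₁ hE₂ rfl hacc
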